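/- Let $k$ be a field with $2\neq 0$ in $k$, $X$ a smooth $k$-scheme (for instance a smooth algebraic variety), $P\in H^0(X,\wedge^2T_X)$ a bivector, $Y\subset X$ a closed subscheme that is smooth over $k$, with ideal sheaf $I_Y$ and normal bundle $N=(I_Y/I_Y^2)^\vee$, and $E$ a vector bundle on $Y$ of positive rank at every point, viewed also as an $\mathcal O_X$-module. Put $\wedge^2N(E)=\wedge^2N\otimes_{\mathcal O_Y}\mathcal End_{\mathcal O_Y}(E)$; its sections are the alternating $\mathcal O_Y$-bilinear maps $I_Y/I_Y^2\times I_Y/I_Y^2\to\mathcal End_{\mathcal O_Y}(E)$. Let $\mathcal O_X\oplus\epsilon\mathcal O_X$ be the sheaf of associative $k[\epsilon]/\epsilon^2$-algebras with product $a*b=ab+\frac{\epsilon}{2}P(da,db)$ for $a,b\in\mathcal O_X$. A first order deformation of $E$ on an affine open $U\subset X$ is a structure of a module over $(\mathcal O_X\oplus\epsilon\mathcal O_X,*)|_U$ on the sheaf of $k[\epsilon]/\epsilon^2$-modules $(E\oplus\epsilon E)|_U$, of the form $a*e=ae+\epsilon\,\alpha(a,e)$ for $a\in\mathcal O_X$,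 $e\in E$, with $\alpha$ a bidifferential operator. First order deformations exist locally on an open $W\subset X$ if every point of $W$ has an affine open neighbourhood $U\subset W$ on which there is one. For a $k$-bilinear $\alpha:\mathcal O_X\times E\to E$ the associativity defect is $$D_\alpha(a,b,e)=\tfrac12P(da,db)e-\bigl(a\,\alpha(b,e)-\alpha(ab,e)+\alpha(a,be)\bigr).$$ The obstruction $\mathrm{ob}(E)$ is the antisymmetrization $(x,y)\mapsto\bigl(e\mapsto D_0(x,y,e)-D_0(y,x,e)\bigr)$, $x,y\in I_Y$, of the defect of the trivial lift $\alpha=0$; it is a section in $H^0(Y,\wedge^2N(E))$. Then: 1. On every affine open of $X$ the obstruction does not depend on the lift: for every $k$-bilinear $\alpha$ and all $x,y\in I_Y$, $e\in E$ one has $\mathrm{ob}(E)(x,y)e=D_\alpha(x,y,e)-D_\alpha(y,x,e)$. 2. The map $H^0(Y,\wedge^2N)\to H^0(Y,\wedge^2N(E))$, $\omega\mapsto\omega\otimes\mathrm{id}_E$, is injective, and $\mathrm{ob}(E)$ is the image under it of the projection of $P$ to $H^0(Y,\wedge^2N)$, that is, of the form $(x,y)\mapsto P(dx,dy)|_Y$.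 3. For every open $W\subset X$, first order deformations of $E$ exist locally on $W$ if and only if $\mathrm{ob}(E)$ vanishes on $W\cap Y$. In particular, first order deformations of $E$ exist locally on $X$ if and only if the projection of $P$ to $H^0(Y,\wedge^2N)$ vanishes. 4. The projection of $P$ to $H^0(Y,\wedge^2N)$ vanishes if and only if $Y$ is coisotropic, i.e. $P(I_Y,I_Y)\subset I_Y$. -/

import Mathlib

open AlgebraicGeometry CategoryTheory

universe u

noncomputable section

namespace FirstOrderDef

/-! ## Algebra over one affine open

`k` is the ground field, `A` a commutative `k`-algebra, `M` an `A`-module. -/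

section Algebra

variable {k : Type*} [Field k] {A : Type*} [CommRing A] [Algebra k A]

/-- `D : M → N` is a `k`-linear differential operator of order `≤ n` between `A`-modules, in the
sense of Grothendieck: it is `A`-linear for `n = 0`, and for `n + 1` all the commutators
`[D, a]` with `a ∈ A` have order `≤ n`. -/
def IsDiffOp (k A : Type*) [Field k] [CommRing A] [Algebra k A]
    {M N : Type*} [AddCommGroup M] [Module A M] [Module k M] [IsScalarTower k A M]
    [AddCommGroup N] [Module A N] [Module k N] [IsScalarTower k A N] :
    ℕ → (M →ₗ[k] N) → Prop
  | 0, D => ∀ (a : A) (m : M), D (a • m) = a • D m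
  | n + 1, D => ∀ a : A,
      IsDiffOp k A n (D ∘ₗ Algebra.lsmul k k M a - Algebra.lsmul k k N a ∘ₗ D)

/-- The algebra `A ⊕ εA` over `k[ε]/ε²` with the product `a ∗ b = a b + ε · ½ P(da, db)`.
A biderivation `P(da, db)` of `A` is written as `P a b`. -/
def Quant (_P : Derivation k A (Derivation k A A)) : Type _ := A × A

namespace Quant

variable (P : Derivation k A (Derivation k A A))

instance : AddCommGroup (Quant P) := inferInstanceAs (AddCommGroup (A × A))

instance : Module k (Quant P) := inferInstanceAs (Module k (A × A))

/-- The element `a + ε b`. -/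
def mk (a b : A) : Quant P := (a, b)

instance : Mul (Quant P) where
  mul a b := mk P (a.1 * b.1) (a.1 * b.2 + a.2 * b.1 + (2 : k)⁻¹ • P a.1 b.1)

instance : One (Quant P) where
  one := mk P 1 0

variable {P}

theorem ext' {a b : Quant P} (h1 : a.1 = b.1) (h2 : a.2 = b.2) : a = b := Prod.ext h1 h2

theorem mul_fst (a b : Quant P) : (a * b).1 = a.1 * b.1 := rfl

theorem mul_snd (a b : Quant P) :
    (a * b).2 = a.1 * b.2 + a.2 * b.1 + (2 : k)⁻¹ • P a.1 b.1 := rfl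

theorem add_fst (a b : Quant P) : (a + b).1 = a.1 + b.1 := rfl

theorem add_snd (a b : Quant P) : (a + b).2 = a.2 + b.2 := rfl

theorem one_fst : (1 : Quant P).1 = 1 := rfl

theorem one_snd : (1 : Quant P).2 = 0 := rfl

theorem zero_fst : (0 : Quant P).1 = 0 := rfl

theorem zero_snd : (0 : Quant P).2 = 0 := rfl

theorem smul_fst (c : k) (a : Quant P) : (c • a).1 = c • a.1 := rfl

theorem smul_snd (c : k) (a : Quant P) : (c • a).2 = c • a.2 := rfl

instance : Ring (Quant P) :=
  { (inferInstance : AddCommGroup (Quant P)), (inferInstance : Mul (Quant P)),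
    (inferInstance : One (Quant P)) with
    left_distrib := fun a b c => by
      apply ext'
      · simp only [mul_fst, add_fst]; ring
      · simp only [mul_snd, add_fst, add_snd, map_add, smul_add]; ring
    right_distrib := fun a b c => by
      apply ext'
      · simp only [mul_fst, add_fst]; ring
      · simp only [mul_snd, add_fst, add_snd, map_add, Derivation.add_apply, smul_add]; ring
    zero_mul := fun a => by
      apply ext' <;> simp [mul_fst, mul_snd, zero_fst, zero_snd]
    mul_zero := fun a => by
      apply ext' <;> simp [mul_fst, mul_snd, zero_fst, zero_snd]
    mul_assoc := fun a b c => by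
      apply ext'
      · simp only [mul_fst]; ring
      · simp only [mul_fst, mul_snd, Derivation.leibniz, Derivation.add_apply,
          Derivation.smul_apply, smul_eq_mul, Algebra.smul_def]; ring
    one_mul := fun a => by
      apply ext' <;> simp [mul_fst, mul_snd, one_fst, one_snd]
    mul_one := fun a => by
      apply ext' <;> simp [mul_fst, mul_snd, one_fst, one_snd] }

instance : Algebra k (Quant P) := Algebra.ofModule
  (fun r x y => by
    apply ext'
    · simp only [mul_fst, smul_fst, smul_mul_assoc]
    · simp only [mul_snd, smul_fst, smul_snd, smul_add,
        smul_mul_assoc, smul_comm r (2 : k)⁻¹]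
      rw [P.map_smul, Derivation.smul_apply])
  (fun r x y => by
    apply ext'
    · simp only [mul_fst, smul_fst, mul_smul_comm]
    · simp only [mul_snd, smul_fst, smul_snd, smul_add,
        mul_smul_comm, smul_comm r (2 : k)⁻¹]
      rw [(P x.1).map_smul])

end Quant

/-- Alternating `A`-bilinear forms on `C` with values in `F`. -/
def altForms (A C F : Type*) [CommRing A] [AddCommGroup C] [Module A C]
    [AddCommGroup F] [Module A F] : Submodule A (C →ₗ[A] C →ₗ[A] F) where
  carrier := {ω | ∀ x, ω x x = 0}
  zero_mem' _ := rfl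
  add_mem' h h' x := by simp [h x, h' x]
  smul_mem' c ω h x := by simp [h x]

/-- A bilinear map on an ideal `I` with values in a module killed by `I` descends to the conormal
module `I/I²`. -/
def descend (I : Ideal A) {F : Type*} [AddCommGroup F] [Module A F]
    (hF : ∀ a ∈ I, ∀ f : F, a • f = 0) (β : I →ₗ[A] I →ₗ[A] F) :
    I.Cotangent →ₗ[A] I.Cotangent →ₗ[A] F :=
  Submodule.liftQ (I • ⊤ : Submodule A I)
    { toFun := fun x => Submodule.liftQ (I • ⊤ : Submodule A I) (β x) (by
        rw [Submodule.smul_le]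
        intro a ha y _
        rw [LinearMap.mem_ker, map_smul]
        exact hF a ha _)
      map_add' := fun x y => by
        refine LinearMap.ext fun z => ?_
        obtain ⟨z, rfl⟩ := I.toCotangent_surjective z
        change β (x + y) z = β x z + β y z
        rw [map_add, LinearMap.add_apply]
      map_smul' := fun a x => by
        refine LinearMap.ext fun z => ?_
        obtain ⟨z, rfl⟩ := I.toCotangent_surjective z
        change β (a • x) z = a • β x z
        rw [map_smul, LinearMap.smul_apply] }
    (by
      rw [Submodule.smul_le]
      intro a ha x _
      rw [LinearMap.mem_ker, map_smul]
      refine LinearMap.ext fun z => ?_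
      obtain ⟨z, rfl⟩ := I.toCotangent_surjective z
      change a • β x z = 0
      exact hF a ha _)

theorem descend_apply (I : Ideal A) {F : Type*} [AddCommGroup F] [Module A F]
    (hF : ∀ a ∈ I, ∀ f : F, a • f = 0) (β : I →ₗ[A] I →ₗ[A] F) (x y : I) :
    descend I hF β (I.toCotangent x) (I.toCotangent y) = β x y := rfl

theorem descend_mem (I : Ideal A) {F : Type*} [AddCommGroup F] [Module A F]
    (hF : ∀ a ∈ I, ∀ f : F, a • f = 0) (β : I →ₗ[A] I →ₗ[A] F) (h : ∀ x, β x x = 0) :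
    descend I hF β ∈ altForms A I.Cotangent F := by
  intro x
  obtain ⟨x, rfl⟩ := I.toCotangent_surjective x
  exact h x

/-- The normal part of an alternating biderivation: `(x, y) ↦ P(dx, dy) mod I` on `I/I²`, that is,
the image of `P` in `∧²N` where `N` is the dual of `I/I²`. -/
def projForm (I : Ideal A) (P : Derivation k A (Derivation k A A)) (hP : ∀ a, P a a = 0) :
    altForms A I.Cotangent (A ⧸ I) :=
  ⟨descend I
    (fun a ha f => by
      obtain ⟨b, rfl⟩ := Ideal.Quotient.mk_surjective f
      change Ideal.Quotient.mk I (a * b) = 0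
      exact Ideal.Quotient.eq_zero_iff_mem.2 (I.mul_mem_right b ha))
    (LinearMap.mk₂ A (fun x y : I => Ideal.Quotient.mk I (P x y))
      (fun x x' y => by simp)
      (fun a x y => by
        change Ideal.Quotient.mk I _ = Ideal.Quotient.mk I (a * P x y)
        rw [Ideal.Quotient.mk_eq_mk_iff_sub_mem]
        have : P ((a • x : I) : A) y - a * P x y = x * P a y := by
          simp [Derivation.leibniz]
        rw [this]
        exact I.mul_mem_right _ x.2)
      (fun x y y' => by simp)
      (fun a x y => by
        change Ideal.Quotient.mk I _ = Ideal.Quotient.mk I (a * P x y)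
        rw [Ideal.Quotient.mk_eq_mk_iff_sub_mem]
        have : P x ((a • y : I) : A) - a * P x y = y * P x a := by
          simp [Derivation.leibniz]
        rw [this]
        exact I.mul_mem_right _ y.2)),
  descend_mem _ _ _ fun x => by simp [hP]⟩

section Mod

variable {M : Type*} [AddCommGroup M] [Module A M]

/-- Multiplication of a module killed by `I` by elements of `A/I`. -/
def scalarEnd (I : Ideal A) (hI : ∀ a ∈ I, ∀ m : M, a • m = 0) : A ⧸ I →ₗ[A] Module.End A M :=
  Submodule.liftQ I (Algebra.linearMap A (Module.End A M)) (fun a ha => by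
    rw [LinearMap.mem_ker]
    exact LinearMap.ext fun m => hI a ha m)

/-- The map `∧²N → ∧²N ⊗ End(M)`, `ω ↦ ω ⊗ id`. -/
def scalarForms (I : Ideal A) (hI : ∀ a ∈ I, ∀ m : M, a • m = 0) :
    altForms A I.Cotangent (A ⧸ I) →ₗ[A] altForms A I.Cotangent (Module.End A M) where
  toFun ω := ⟨(LinearMap.compRight A (scalarEnd I hI)).comp ω.1, fun x => by
    change scalarEnd I hI (ω.1 x x) = 0
    rw [ω.2 x, map_zero]⟩
  map_add' ω ω' := by
    refine Subtype.ext (LinearMap.ext fun x => LinearMap.ext fun y => ?_)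
    exact map_add (scalarEnd I hI) _ _
  map_smul' a ω := by
    refine Subtype.ext (LinearMap.ext fun x => LinearMap.ext fun y => ?_)
    exact map_smul (scalarEnd I hI) a _

theorem scalarForms_apply (I : Ideal A) (hI : ∀ a ∈ I, ∀ m : M, a • m = 0)
    (ω : altForms A I.Cotangent (A ⧸ I)) (x y : I.Cotangent) :
    (scalarForms I hI ω).1 x y = scalarEnd I hI (ω.1 x y) := rfl

variable [Module k M] [IsScalarTower k A M]

/-- For a `k`-bilinear `α : A × M → M` let `a ∈ A` act on `M ⊕ εM` by `m ↦ a m + ε α(a, m)`.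
This is the coefficient of `ε` in `(a ∗ b) m - a (b m)`, where `∗` is the product of `A ⊕ εA`. -/
def assocDefect (P : Derivation k A (Derivation k A A)) (α : A →ₗ[k] M →ₗ[k] M)
    (a b : A) (m : M) : M :=
  ((2 : k)⁻¹ • P a b) • m - (a • α b m - α (a * b) m + α a (b • m))

/-- The antisymmetrization on `I` of the associativity defect of the trivial lift `α = 0`, as an
alternating form on `I/I²` with values in the endomorphisms of `M`. -/
def obstrForm (I : Ideal A) (hI : ∀ a ∈ I, ∀ m : M, a • m = 0)
    (P : Derivation k A (Derivation k A A)) :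
    altForms A I.Cotangent (Module.End A M) :=
  ⟨descend I (fun a ha f => LinearMap.ext fun m => hI a ha (f m))
    (LinearMap.mk₂ A
      (fun x y : I =>
        { toFun := fun m => assocDefect P 0 (x : A) y m - assocDefect P 0 (y : A) x m
          map_add' := fun m m' => by simp [assocDefect]; abel
          map_smul' := fun a m => by simp [assocDefect, smul_sub, smul_comm a] })
      (fun x x' y => by
        ext m
        simp [assocDefect, add_smul]; abel)
      (fun a x y => by
        ext m
        have h := hI x x.2
        simp [assocDefect, Derivation.leibniz, add_smul, mul_smul, smul_sub, smul_add,
          smul_comm a (2 : k)⁻¹, h])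
      (fun x y y' => by
        ext m
        simp [assocDefect, add_smul]; abel)
      (fun a x y => by
        ext m
        have h := hI y y.2
        simp [assocDefect, Derivation.leibniz, add_smul, mul_smul, smul_sub, smul_add,
          smul_comm a (2 : k)⁻¹, h])),
  descend_mem _ _ _ fun x => by ext m; simp⟩

theorem obstrForm_apply (I : Ideal A) (hI : ∀ a ∈ I, ∀ m : M, a • m = 0)
    (P : Derivation k A (Derivation k A A)) (x y : I) (m : M) :
    (obstrForm I hI P).1 (I.toCotangent x) (I.toCotangent y) m =
      assocDefect P 0 (x : A) y m - assocDefect P 0 (y : A) x m := rfl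

end Mod

end Algebra

/-! ## Schemes over a field -/

section Schemes

variable {k : Type u} [Field k] {X Y : Scheme.{u}} [X.Over (Spec (.of k))]

/-- Functions on an open subset of a `k`-scheme form a `k`-algebra. -/
instance sectionsAlgebra (V : X.Opens) : Algebra k Γ(X, V) :=
  (((X ↘ Spec (.of k)).appLE ⊤ V le_top).hom.comp
    (Scheme.ΓSpecIso (.of k)).inv.hom).toAlgebra

instance sectionsModule (M : X.Modules) (V : X.Opens) : Module k Γ(M, V) :=
  Module.compHom _ (algebraMap k Γ(X, V))

instance (M : X.Modules) (V : X.Opens) : IsScalarTower k Γ(X, V) Γ(M, V) where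
  smul_assoc c a m := by
    rw [Algebra.smul_def, mul_smul]
    rfl

/-- Restriction of functions from `V` to `W ⊆ V`. -/
abbrev res {V W : X.Opens} (h : W ≤ V) (a : Γ(X, V)) : Γ(X, W) :=
  (X.presheaf.map (homOfLE h).op).hom a

theorem res_algebraMap {V W : X.Opens} (h : W ≤ V) (c : k) :
    res h (algebraMap k Γ(X, V) c) = algebraMap k Γ(X, W) c := by
  have := congr($((X ↘ Spec (.of k)).appLE_map (U := ⊤) (V := V) le_top (homOfLE h).op).hom
    ((Scheme.ΓSpecIso (.of k)).inv.hom c))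
  exact this

/-- Restriction of sections of an `𝒪_X`-module from `V` to `W ⊆ V`. -/
abbrev resMod (M : X.Modules) {V W : X.Opens} (h : W ≤ V) (m : Γ(M, V)) : Γ(M, W) :=
  (M.presheaf.map (homOfLE h).op).hom m

/-- An `𝒪_Y`-module is a vector bundle of positive rank: every point has an open neighbourhood
`V` on which there are sections `e₁, …, eₙ` with `n > 0` that are a basis of the sections on
every open subset of `V`, i.e. the restriction to `V` is isomorphic to `𝒪ⁿ`. -/
def IsVectorBundle (E : Y.Modules) : Prop :=
  ∀ y : Y, ∃ V : Y.Opens, y ∈ V ∧ ∃ n : ℕ, 0 < n ∧ ∃ e : Fin n → Γ(E, V),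
    ∀ (W : Y.Opens) (h : W ≤ V),
      Function.Bijective fun c : Fin n → Γ(Y, W) => ∑ j, c j • resMod E h (e j)

variable (k X) in
/-- A bivector `P ∈ H⁰(X, ∧²T_X)` on a smooth `k`-scheme: an alternating `k`-biderivation
`(a, b) ↦ P(da, db)` of the functions on every affine open, compatibly with restriction. -/
structure Bivector where
  der (V : X.affineOpens) : Derivation k Γ(X, V) (Derivation k Γ(X, V) Γ(X, V))
  alt (V : X.affineOpens) (a : Γ(X, V)) : der V a a = 0
  map (V W : X.affineOpens) (h : W.1 ≤ V.1) (a b : Γ(X, V)) :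
    res h (der V a b) = der W (res h a) (res h b)

/-- The ideal of functions on `V` that vanish on the closed subscheme `i : Y ⟶ X`. -/
def idealOf (i : Y ⟶ X) (V : X.Opens) : Ideal Γ(X, V) := RingHom.ker (i.app V).hom

theorem idealOf_res (i : Y ⟶ X) {V W : X.Opens} (h : W ≤ V) {a : Γ(X, V)}
    (ha : a ∈ idealOf i V) : res h a ∈ idealOf i W := by
  have := congr($(i.naturality (homOfLE h).op).hom a)
  simp only [CommRingCat.hom_comp, RingHom.comp_apply] at this
  rw [idealOf, RingHom.mem_ker] at ha ⊢
  erw [this, ha, map_zero]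

/-- `Y` is coisotropic: `P(I_Y, I_Y) ⊆ I_Y`. -/
def IsCoisotropic (P : Bivector k X) (i : Y ⟶ X) : Prop :=
  ∀ (V : X.affineOpens), ∀ x ∈ idealOf i V.1, ∀ y ∈ idealOf i V.1, P.der V x y ∈ idealOf i V.1

/-- The `𝒪_Y`-module `E` viewed as an `𝒪_X`-module. -/
def push (i : Y ⟶ X) (E : Y.Modules) : X.Modules := (Scheme.Modules.pushforward i).obj E

theorem idealOf_smul (i : Y ⟶ X) (E : Y.Modules) (V : X.Opens) :
    ∀ a ∈ idealOf i V, ∀ m : Γ(push i E, V), a • m = 0 := by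
  intro a ha m
  have h : a • m = (show Γ(E, i ⁻¹ᵁ V) from ((i.app V).hom a • (show Γ(E, i ⁻¹ᵁ V) from m))) := rfl
  rw [h, show (i.app V).hom a = 0 from ha]
  exact zero_smul Γ(Y, i ⁻¹ᵁ V) (show Γ(E, i ⁻¹ᵁ V) from m)

/-- The conormal class of a function that vanishes on `Y`. -/
def conormal (i : Y ⟶ X) (V : X.Opens) (x : Γ(X, V)) (hx : x ∈ idealOf i V) :
    (idealOf i V).Cotangent := (idealOf i V).toCotangent ⟨x, hx⟩

variable (i : Y ⟶ X)

/-- `H⁰(Y, ∧²N)`, where `N` is the normal bundle, the dual of `I/I²`: alternating forms on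
`I(V)/I(V)²` with values in `𝒪_X(V)/I(V) = 𝒪_Y(V ∩ Y)` for all affine opens `V` of `X`,
compatible with restriction. -/
def wedgeN : AddSubgroup (∀ V : X.affineOpens,
    altForms Γ(X, V) (idealOf i V.1).Cotangent (Γ(X, V) ⧸ idealOf i V.1)) where
  carrier := {ω | ∀ (V W : X.affineOpens) (h : W.1 ≤ V.1) (x y : Γ(X, V))
    (hx : x ∈ idealOf i V.1) (hy : y ∈ idealOf i V.1),
    (ω W).1 (conormal i W.1 (res h x) (idealOf_res i h hx))
        (conormal i W.1 (res h y) (idealOf_res i h hy)) =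
      Ideal.quotientMap (idealOf i W.1) (X.presheaf.map (homOfLE h).op).hom
        (fun _ ha => idealOf_res i h ha)
        ((ω V).1 (conormal i V.1 x hx) (conormal i V.1 y hy))}
  zero_mem' V W h x y hx hy := by
    change (0 : Γ(X, W) ⧸ idealOf i W.1) = Ideal.quotientMap _ _ _ (0 : Γ(X, V) ⧸ idealOf i V.1)
    rw [map_zero]
  add_mem' {ω ω'} hω hω' V W h x y hx hy := by
    have h1 := hω V W h x y hx hy
    have h2 := hω' V W h x y hx hy
    simp only [Pi.add_apply, Submodule.coe_add, LinearMap.add_apply, map_add, h1, h2]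
  neg_mem' {ω} hω V W h x y hx hy := by
    exact (congrArg Neg.neg (hω V W h x y hx hy)).trans (map_neg _ _).symm

/-- `H⁰(Y, ∧²N(E))`, where `∧²N(E) = ∧²N ⊗ End(E)`: alternating forms on `I(V)/I(V)²` with
values in the endomorphisms of `E(V ∩ Y)` for all affine opens `V` of `X`, compatible with
restriction. -/
def wedgeNEnd (E : Y.Modules) : AddSubgroup (∀ V : X.affineOpens,
    altForms Γ(X, V) (idealOf i V.1).Cotangent (Module.End Γ(X, V) Γ(push i E, V))) where
  carrier := {ω | ∀ (V W : X.affineOpens) (h : W.1 ≤ V.1) (x y : Γ(X, V))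
    (hx : x ∈ idealOf i V.1) (hy : y ∈ idealOf i V.1) (e : Γ(push i E, V)),
    (ω W).1 (conormal i W.1 (res h x) (idealOf_res i h hx))
        (conormal i W.1 (res h y) (idealOf_res i h hy)) (resMod (push i E) h e) =
      resMod (push i E) h ((ω V).1 (conormal i V.1 x hx) (conormal i V.1 y hy) e)}
  zero_mem' V W h x y hx hy e := by
    change (0 : Γ(push i E, W)) = resMod (push i E) h (0 : Γ(push i E, V))
    exact (map_zero _).symm
  add_mem' {ω ω'} hω hω' V W h x y hx hy e := by
    have h1 := hω V W h x y hx hy e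
    have h2 := hω' V W h x y hx hy e
    simp only [Pi.add_apply, Submodule.coe_add, LinearMap.add_apply, map_add, h1, h2]
  neg_mem' {ω} hω V W h x y hx hy e := by
    exact (congrArg Neg.neg (hω V W h x y hx hy e)).trans (map_neg _ _).symm

theorem scalarEnd_res (E : Y.Modules) {V W : X.Opens} (h : W ≤ V) (c : Γ(X, V) ⧸ idealOf i V)
    (e : Γ(push i E, V)) :
    scalarEnd (idealOf i W) (idealOf_smul i E W)
        (Ideal.quotientMap (idealOf i W) (X.presheaf.map (homOfLE h).op).hom
          (fun _ ha => idealOf_res i h ha) c) (resMod (push i E) h e) =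
      resMod (push i E) h (scalarEnd (idealOf i V) (idealOf_smul i E V) c e) := by
  obtain ⟨a, rfl⟩ := Ideal.Quotient.mk_surjective c
  exact (Scheme.Modules.map_smul (push i E) (homOfLE h) a e).symm

theorem inclusion_mem (E : Y.Modules) (ω : wedgeN i) :
    (fun V : X.affineOpens => scalarForms (idealOf i V.1) (idealOf_smul i E V.1) (ω.1 V)) ∈
      wedgeNEnd i E := fun V W h x y hx hy e =>
  (congrArg (fun c => scalarEnd (idealOf i W.1) (idealOf_smul i E W.1) c
    (resMod (push i E) h e)) (ω.2 V W h x y hx hy)).trans (scalarEnd_res i E h _ e)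

/-- The map `H⁰(Y, ∧²N) → H⁰(Y, ∧²N(E))`, `ω ↦ ω ⊗ id`. -/
def inclusion (E : Y.Modules) : wedgeN i →+ wedgeNEnd i E :=
  AddMonoidHom.mk' (fun ω => ⟨_, inclusion_mem i E ω⟩) (fun ω ω' =>
    Subtype.ext (funext fun V =>
      map_add (scalarForms (idealOf i V.1) (idealOf_smul i E V.1)) (ω.1 V) (ω'.1 V)))

/-- The projection `H⁰(X, ∧²T_X) → H⁰(Y, ∧²N)`. -/
def proj (P : Bivector k X) : wedgeN i :=
  ⟨fun V => projForm (idealOf i V.1) (P.der V) (P.alt V), by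
    intro V W h x y hx hy
    change Ideal.Quotient.mk _ (P.der W (res h x) (res h y)) =
      Ideal.Quotient.mk _ (res h (P.der V x y))
    rw [P.map]⟩

/-- The obstruction in `H⁰(Y, ∧²N(E))` to a local first order deformation of `E`: the
antisymmetrization on `I_Y` of the associativity defect of the trivial lift. -/
def obstruction (E : Y.Modules) (P : Bivector k X) : wedgeNEnd i E :=
  ⟨fun V => obstrForm (idealOf i V.1) (idealOf_smul i E V.1) (P.der V), by
    intro V W h x y hx hy e
    have key : ∀ a b : Γ(X, V), assocDefect (P.der W) 0 (res h a) (res h b)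
        (resMod (push i E) h e) = resMod (push i E) h (assocDefect (P.der V) 0 a b e) := by
      intro a b
      have h1 : ((2 : k)⁻¹ • P.der W (res h a) (res h b)) = res h ((2 : k)⁻¹ • P.der V a b) := by
        rw [← P.map, Algebra.smul_def, Algebra.smul_def, ← res_algebraMap h]
        exact (map_mul _ _ _).symm
      simp only [assocDefect, LinearMap.zero_apply, smul_zero, sub_zero, add_zero]
      rw [h1]
      exact (Scheme.Modules.map_smul (push i E) (homOfLE h) _ e).symm
    change assocDefect (P.der W) 0 _ _ _ - assocDefect (P.der W) 0 _ _ _ =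
      resMod (push i E) h (assocDefect (P.der V) 0 x y e - assocDefect (P.der V) 0 y x e)
    rw [key, key]
    exact (map_sub _ _ _).symm⟩

/-- A first order deformation of `E` on an affine open `U` of `X`: the sheaf
`(E ⊕ εE)|_U` is made into a module over the sheaf of algebras `(𝒪_X ⊕ ε𝒪_X, ∗)|_U`, in such a way
that `ε` acts by `e₀ + εe₁ ↦ εe₀`, the action is the given one modulo `ε`, and in
`a · e = a e + ε α(a, e)` the map `α` is a bidifferential operator.  The sheaves are given by
their sections on the affine open subsets of `U`. -/
structure FirstOrderDeformation (P : Bivector k X) (E : Y.Modules) (U : X.affineOpens) where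
  act (V : X.affineOpens) (hV : V.1 ≤ U.1) :
    Quant (P.der V) →ₐ[k] Module.End k (Γ(push i E, V) × Γ(push i E, V))
  act_eps (V : X.affineOpens) (hV : V.1 ≤ U.1) (e : Γ(push i E, V) × Γ(push i E, V)) :
    act V hV (Quant.mk _ 0 1) e = (0, e.1)
  act_fst (V : X.affineOpens) (hV : V.1 ≤ U.1) (a b : Γ(X, V))
      (e : Γ(push i E, V) × Γ(push i E, V)) :
    (act V hV (Quant.mk _ a b) e).1 = a • e.1
  act_res (V W : X.affineOpens) (hV : V.1 ≤ U.1) (h : W.1 ≤ V.1) (a b : Γ(X, V))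
      (e : Γ(push i E, V) × Γ(push i E, V)) :
    act W (h.trans hV) (Quant.mk _ (res h a) (res h b))
        (resMod (push i E) h e.1, resMod (push i E) h e.2) =
      (resMod (push i E) h (act V hV (Quant.mk _ a b) e).1,
        resMod (push i E) h (act V hV (Quant.mk _ a b) e).2)
  bidiff : ∃ n : ℕ, ∀ (V : X.affineOpens) (hV : V.1 ≤ U.1),
    ∃ α : Γ(X, V) →ₗ[k] Γ(push i E, V) →ₗ[k] Γ(push i E, V),
      (∀ a e, act V hV (Quant.mk _ a 0) (e, 0) = (a • e, α a e)) ∧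
      (∀ e, IsDiffOp k Γ(X, V) n (α.flip e)) ∧ (∀ a, IsDiffOp k Γ(X, V) n (α a))

/-- Locally on the open subset `W` of `X` there exists a first order deformation of `E`. -/
def LocallyDeformable (P : Bivector k X) (E : Y.Modules) (W : X.Opens) : Prop :=
  ∀ p ∈ W, ∃ U : X.affineOpens, p ∈ U.1 ∧ U.1 ≤ W ∧ Nonempty (FirstOrderDeformation i P E U)

end Schemes

end FirstOrderDef

end

noncomputable section

namespace FirstOrderDef

/-! ## Differential operators -/

section DiffOp

variable {k A : Type*} [Field k] [CommRing A] [Algebra k A]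
  {M N : Type*} [AddCommGroup M] [Module A M] [Module k M] [IsScalarTower k A M]
  [AddCommGroup N] [Module A N] [Module k N] [IsScalarTower k A N]

/-! For `x, y ∈ I_Y` the antisymmetrized defect of any lift is `P(dx, dy)e`. The ideal kills `E`, so
`x α(y, e)` and `α(x, ye)` vanish, while `α(xy, e)` is symmetric and cancels; the two halves of `P`
add up by antisymmetry. This gives independence of the lift, and the obstruction is the normal part
of `P` times the identity. Since `E` has positive rank, it is locally a faithful `𝒪_Y`-module, so `ω
↦ ω ⊗ id` is injective and vanishing of the obstruction means `P(I_Y, I_Y) ⊆ I_Y`.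

The action axioms force `D_α = 0` for the `α` of a deformation, so local deformations make the
obstruction vanish locally, hence everywhere by the sheaf property.

The converse rests on `exists_decomposition`. By smoothness the conormal sequence of `Y` in an
affine `U` splits, so every derivation in a generating system of `X` is a sum `v + u`, where `v`
maps `I` into `I` and `u` factors modulo `I` through the chosen projection to the conormal module.
If `P(I, I) ⊆ I`, the `u ⊗ u` terms of `P` vanish modulo `I`. The other terms are Hochschild
coboundaries on `E`: a frame of `E` gives connections along the `v`, and each product with at least
one `v` has an explicit primitive (`liftTerm_coboundary`). No connection along `u` is needed. The
resulting `α` has zero defect and defines the action on all of `U`.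

A deformation is required on every affine `V ≤ U`, compatibly with restriction. As `𝒪(U) → 𝒪(V)` is
étale, derivations extend uniquely to `V`; uniqueness then carries all identities from `U` to `V`.
-/

theorem IsDiffOp.zero (n : ℕ) : IsDiffOp k A n (0 : M →ₗ[k] N) := by
  induction n with
  | zero => intro a m; simp
  | succ n ih => intro a; simpa using ih

theorem IsDiffOp.succ {n : ℕ} {D : M →ₗ[k] N} (h : IsDiffOp k A n D) :
    IsDiffOp k A (n + 1) D := by
  induction n generalizing D with
  | zero =>
    intro a
    convert IsDiffOp.zero (k := k) (A := A) (M := M) (N := N) 0 using 1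
    ext m
    simp [h a m]
  | succ n ih => exact fun a => ih (h a)

theorem IsDiffOp.add {n : ℕ} {D D' : M →ₗ[k] N} (h : IsDiffOp k A n D)
    (h' : IsDiffOp k A n D') : IsDiffOp k A n (D + D') := by
  induction n generalizing D D' with
  | zero => intro a m; simp [h a m, h' a m]
  | succ n ih =>
    intro a
    convert ih (h a) (h' a) using 1
    ext m
    simp only [LinearMap.sub_apply, LinearMap.add_apply, LinearMap.comp_apply, map_add]
    abel

theorem IsDiffOp.smul {n : ℕ} {D : M →ₗ[k] N} (c : k) (h : IsDiffOp k A n D) :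
    IsDiffOp k A n (c • D) := by
  induction n generalizing D with
  | zero => intro a m; simp [h a m, smul_comm a c]
  | succ n ih =>
    intro a
    convert ih (h a) using 1
    ext m
    simp [smul_sub, smul_comm a c]

theorem IsDiffOp.sum {n : ℕ} {ι : Type*} (s : Finset ι) {D : ι → M →ₗ[k] N}
    (h : ∀ i, IsDiffOp k A n (D i)) : IsDiffOp k A n (∑ i ∈ s, D i) :=
  Finset.sum_induction _ (IsDiffOp k A n) (fun _ _ => .add) (.zero n) fun i _ => h i

end DiffOp

/-! ## Derivations -/

section Derivation

open TensorProduct KaehlerDifferential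

variable {k A B : Type*} [Field k] [CommRing A] [Algebra k A] [CommRing B] [Algebra k B]
  [Algebra A B] [IsScalarTower k A B]

/-- The difference vanishes on the image of `A`, so it is an `A`-derivation of `B` and factors
through `Ω[B⁄A] = 0`. -/
theorem derivation_ext_of_formallyUnramified {k A B : Type*} [Field k] [CommRing A] [CommRing B]
    [Algebra k B] [Algebra A B] [Algebra.FormallyUnramified A B]
    {M : Type*} [AddCommGroup M] [Module k M] [Module B M] [IsScalarTower k B M]
    {D D' : Derivation k B M} (h : ∀ a, D (algebraMap A B a) = D' (algebraMap A B a)) :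
    D = D' := by
  let : Module A M := Module.compHom M (algebraMap A B)
  have : IsScalarTower A B M := IsScalarTower.of_algebraMap_smul fun _ _ => rfl
  have hE : ∀ a, (D - D') (algebraMap A B a) = 0 := fun a => by simp [h a]
  let E : Derivation A B M := Derivation.mk'
    { toFun := (D - D' :)
      map_add' := map_add (D - D')
      map_smul' := fun a b => by
        rw [Algebra.smul_def, Derivation.leibniz, hE, smul_zero, add_zero, algebraMap_smul]
        rfl } fun b c => (D - D').leibniz b c
  ext b
  have : E b = 0 := by
    rw [← E.liftKaehlerDifferential_comp_D b,
      Subsingleton.elim (KaehlerDifferential.D A B b) 0, map_zero]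
  exact sub_eq_zero.1 this

/-- The extension of a derivation of `A` to a formally étale `A`-algebra. -/
def extendDerivation (B : Type*) [CommRing B] [Algebra k B] [Algebra A B] [IsScalarTower k A B]
    [Algebra.FormallyEtale A B] (D : Derivation k A A) : Derivation k B B :=
  ((((Algebra.linearMap A B) ∘ₗ D.liftKaehlerDifferential).liftBaseChange B) ∘ₗ
    (tensorKaehlerEquivOfFormallyEtale k A B).symm.toLinearMap).compDer (KaehlerDifferential.D k B)

theorem extendDerivation_algebraMap [Algebra.FormallyEtale A B] (D : Derivation k A A) (a : A) :
    extendDerivation B D (algebraMap A B a) = algebraMap A B (D a) := by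
  simp [extendDerivation, tensorKaehlerEquivOfFormallyEtale_symm_D_algebraMap]

/-- Over a smooth algebra `A` with a formally smooth quotient `B`, a biderivation that is zero
on the kernel `I` of `A → B` decomposes modulo `I` into products of derivations `v` that
preserve `I` and further derivations `u`, without terms that involve only the `u`. -/
theorem exists_decomposition [Algebra.Smooth k A] [Algebra.FormallySmooth k B]
    (hf : Function.Surjective (algebraMap A B)) (P : Derivation k A (Derivation k A A))
    (hP : ∀ x y, algebraMap A B x = 0 → algebraMap A B y = 0 → algebraMap A B (P x y) = 0) :
    ∃ (n : ℕ) (p : Fin n → Fin n → A) (u v : Fin n → Derivation k A A)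
      (w : Fin n → Derivation k B B),
      (∀ i a, w i (algebraMap A B a) = algebraMap A B (v i a)) ∧
      ∀ a b, algebraMap A B (P a b) = algebraMap A B
        (∑ i, ∑ j, p i j * (v i a * v j b + v i a * u j b + u i a * v j b)) := by
  -- Formal smoothness of `B` gives a retraction `l` of the conormal map `I/I² → B ⊗ Ω[A⁄k]`.
  obtain ⟨l, hl⟩ := (Algebra.FormallySmooth.iff_split_injection (R := k) hf).1 inferInstance
  -- `Ω[A⁄k]` is a direct summand of `Aⁿ`: `g` embeds it and `s` is a left inverse of `g`. The
  -- components of `g ∘ d` are the derivations `f i` below.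
  obtain ⟨n, s, g, -, -, hsg⟩ := Module.Finite.exists_comp_eq_id_of_projective A (Ω[A⁄k])
  let q : (Fin n → A) →ₗ[A] (Fin n → B) := (Algebra.linearMap A B).compLeft (Fin n)
  have hq : Function.Surjective q := fun b =>
    ⟨fun i => Function.surjInv hf (b i), funext fun i => Function.surjInv_eq hf (b i)⟩
  let G : B ⊗[A] Ω[A⁄k] →ₗ[A] (Fin n → B) := ((q ∘ₗ g).liftBaseChange B).restrictScalars A
  have hG : ∀ ω, G (1 ⊗ₜ ω) = q (g ω) := fun ω => by simp [G]
  -- The projector of `B ⊗ Ω[A⁄k]` onto its conormal part, written in the coordinates `g`, has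
  -- values in `Bⁿ`; projectivity of `Ω[A⁄k]` lifts it to `Aⁿ`.
  obtain ⟨h, hh⟩ := Module.projective_lifting_property q
    (G ∘ₗ kerCotangentToTensor k A B ∘ₗ l ∘ₗ TensorProduct.mk A B (Ω[A⁄k]) 1) hq
  have hh' : ∀ ω, q (h ω) = G (kerCotangentToTensor k A B (l (1 ⊗ₜ ω))) := fun ω =>
    LinearMap.congr_fun hh ω
  let d := KaehlerDifferential.D k A
  -- Modulo `I`, `u` at `a` equals `f` at some `x ∈ I` representing the conormal class `l (1 ⊗ da)`.
  have h1 : ∀ a, ∃ x, algebraMap A B x = 0 ∧ q (h (d a)) = q (g (d x)) := fun a => by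
    obtain ⟨x, hx⟩ := (RingHom.ker (algebraMap A B)).toCotangent_surjective (l (1 ⊗ₜ d a))
    refine ⟨x, x.2, ?_⟩
    rw [hh', ← hx, kerCotangentToTensor_toCotangent, hG]
  -- Because `l` is a retraction, `u` and `f` agree modulo `I` on `I` itself, so `f - u` preserves
  -- `I` and descends to `B`.
  have h2 : ∀ x, algebraMap A B x = 0 → q (h (d x)) = q (g (d x)) := fun x hx => by
    have := LinearMap.congr_fun hl ((RingHom.ker (algebraMap A B)).toCotangent ⟨x, hx⟩)
    rw [LinearMap.comp_apply, kerCotangentToTensor_toCotangent] at this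
    rw [hh', this, LinearMap.id_apply, kerCotangentToTensor_toCotangent, hG]
  let u : Fin n → Derivation k A A := fun i => (LinearMap.proj i ∘ₗ h).compDer d
  let f : Fin n → Derivation k A A := fun i => (LinearMap.proj i ∘ₗ g).compDer d
  have hu : ∀ i x, algebraMap A B x = 0 → algebraMap A B ((f i - u i) x) = 0 := fun i x hx => by
    have := congrFun (h2 x hx) i
    change algebraMap A B (g (d x) i - h (d x) i) = 0
    rw [map_sub, sub_eq_zero]
    exact this.symm
  let w : Fin n → Derivation k B B := fun i =>
    Derivation.liftOfSurjective (f := IsScalarTower.toAlgHom k A B) hf (d := f i - u i) (hu i)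
  have hw : ∀ i a, w i (algebraMap A B a) = algebraMap A B ((f i - u i) a) := fun i =>
    Derivation.liftOfSurjective_apply (f := IsScalarTower.toAlgHom k A B) hf (hu i)
  let p : Fin n → Fin n → A := fun i j =>
    (P.liftKaehlerDifferential (s (Pi.single i 1))).liftKaehlerDifferential (s (Pi.single j 1))
  have hs : ∀ a, d a = ∑ i, f i a • s (Pi.single i 1) := fun a => by
    conv_lhs => rw [← LinearMap.id_apply (R := A) (d a), ← hsg, LinearMap.comp_apply,
      pi_eq_sum_univ' (g (d a)), map_sum]
    refine Finset.sum_congr rfl fun i _ => ?_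
    rw [map_smul]
    rfl
  have hp : ∀ a b, P a b = ∑ i, ∑ j, p i j * (f i a * f j b) := fun a b => by
    have h3 : ∀ Q : Derivation k A A, Q b =
        ∑ j, f j b • Q.liftKaehlerDifferential (s (Pi.single j 1)) := fun Q => by
      rw [← Q.liftKaehlerDifferential_comp_D b]
      change Q.liftKaehlerDifferential (d b) = _
      rw [hs b, map_sum]
      exact Finset.sum_congr rfl fun j _ => map_smul _ _ _
    have h4 : P a = ∑ i, f i a • P.liftKaehlerDifferential (s (Pi.single i 1)) := by
      rw [← P.liftKaehlerDifferential_comp_D a]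
      change P.liftKaehlerDifferential (d a) = _
      rw [hs a, map_sum]
      exact Finset.sum_congr rfl fun j _ => map_smul _ _ _
    rw [h4, ← Derivation.coeFnAddMonoidHom_apply, map_sum, Finset.sum_apply]
    refine Finset.sum_congr rfl fun i _ => ?_
    change f i a • (P.liftKaehlerDifferential (s (Pi.single i 1))) b = _
    rw [h3, Finset.smul_sum]
    refine Finset.sum_congr rfl fun j _ => ?_
    simp only [p, smul_eq_mul]
    ring
  refine ⟨n, p, u, fun i => f i - u i, w, hw, fun a b => ?_⟩
  obtain ⟨x, hx, hax⟩ := h1 a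
  obtain ⟨y, hy, hby⟩ := h1 b
  -- By the choice of `x, y ∈ I`, the pure `u` part at `(a, b)` is `P x y` modulo `I`, which is zero
  -- by assumption.
  have key : algebraMap A B (∑ i, ∑ j, p i j * (u i a * u j b)) = 0 := by
    rw [← hP x y hx hy, hp]
    simp only [map_sum, map_mul]
    refine Finset.sum_congr rfl fun i _ => Finset.sum_congr rfl fun j _ => ?_
    congr 2
    · exact congrFun hax i
    · exact congrFun hby j
  rw [← sub_eq_zero, ← map_sub, ← key, hp, ← Finset.sum_sub_distrib]
  congr 1
  refine Finset.sum_congr rfl fun i _ => ?_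
  rw [← Finset.sum_sub_distrib]
  refine Finset.sum_congr rfl fun j _ => ?_
  simp only [Derivation.sub_apply]
  ring

end Derivation

/-! ## The lift attached to a decomposition of a biderivation -/

section Lift

variable {k A M : Type*} [Field k] [CommRing A] [Algebra k A]
  [AddCommGroup M] [Module A M] [Module k M] [IsScalarTower k A M]

/-- The bidifferential operator whose Hochschild coboundary is
`p (v a · v' b + v a · u' b + u a · v' b)` when `D`, `D'` are connections along `v`, `v'`. -/
def liftTerm (p : A) (u v u' : Derivation k A A) (D D' : M →ₗ[k] M) : A →ₗ[k] M →ₗ[k] M :=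
  LinearMap.mk₂ k (fun a e => p • ((v a + u a) • D' e - u' a • D e - u' (v a) • e))
    (fun a b e => by simp only [map_add]; module)
    (fun c a e => by
      simp only [Derivation.map_smul, ← smul_add, smul_assoc, ← smul_sub, smul_comm p c])
    (fun a e e' => by simp only [map_add]; module)
    (fun c a e => by
      simp only [map_smul, smul_comm (_ : A) c, ← smul_sub])

theorem liftTerm_apply (p : A) (u v u' : Derivation k A A) (D D' : M →ₗ[k] M) (a : A) (e : M) :
    liftTerm p u v u' D D' a e = p • ((v a + u a) • D' e - u' a • D e - u' (v a) • e) := rfl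

variable {p : A} {u v u' v' : Derivation k A A} {D D' : M →ₗ[k] M}

/-- The Leibniz rule of `D'` turns `(v a + u a) D' e` into `(v a + u a) v' b`, and `-u' a · D e`
contributes the unwanted `-u' a · v b`. The failure of `u' ∘ v` to be a derivation is `u' a · v b +
v a · u' b`: it cancels the unwanted term and supplies the missing mixed one. -/
theorem liftTerm_coboundary (hD : ∀ a e, D (a • e) = a • D e + v a • e)
    (hD' : ∀ a e, D' (a • e) = a • D' e + v' a • e) (a b : A) (e : M) :
    a • liftTerm p u v u' D D' b e - liftTerm p u v u' D D' (a * b) e +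
        liftTerm p u v u' D D' a (b • e) =
      (p * (v a * v' b + v a * u' b + u a * v' b)) • e := by
  simp only [liftTerm_apply, hD, hD', Derivation.leibniz, map_add, smul_eq_mul]
  module

theorem isDiffOp_liftTerm_flip (p : A) (u v u' : Derivation k A A) (D D' : M →ₗ[k] M) (e : M) :
    IsDiffOp k A 2 ((liftTerm p u v u' D D').flip e) := by
  -- Two commutators, then linearity. Order two is due to the composite `u' ∘ v`.
  intro a b c m
  simp only [LinearMap.sub_apply, LinearMap.comp_apply, Algebra.lsmul_coe, LinearMap.flip_apply,
    liftTerm_apply, Derivation.leibniz, map_add, smul_eq_mul]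
  module

theorem isDiffOp_liftTerm (hD : ∀ a e, D (a • e) = a • D e + v a • e)
    (hD' : ∀ a e, D' (a • e) = a • D' e + v' a • e) (a : A) :
    IsDiffOp k A 2 (liftTerm p u v u' D D' a) := by
  -- In the module variable the order is one; it is raised to two to share a bound with the function
  -- variable.
  refine IsDiffOp.succ fun b c e => ?_
  simp only [LinearMap.sub_apply, LinearMap.comp_apply, Algebra.lsmul_coe,
    liftTerm_apply, hD, hD']
  module

/-- The lift `α` attached to a decomposition of a biderivation. -/
def liftOf {n : ℕ} (p : Fin n → Fin n → A) (u v : Fin n → Derivation k A A)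
    (D : Fin n → M →ₗ[k] M) : A →ₗ[k] M →ₗ[k] M :=
  (2 : k)⁻¹ • ∑ i, ∑ j, liftTerm (p i j) (u i) (v i) (u j) (D i) (D j)

variable {n : ℕ} {q : Fin n → Fin n → A} {U V : Fin n → Derivation k A A}
  {E : Fin n → M →ₗ[k] M}

theorem liftOf_apply (a : A) (e : M) : liftOf q U V E a e =
    (2 : k)⁻¹ • ∑ i, ∑ j, liftTerm (q i j) (U i) (V i) (U j) (E i) (E j) a e := by
  simp [liftOf, LinearMap.sum_apply]

theorem assocDefect_liftOf (hE : ∀ i a e, E i (a • e) = a • E i e + V i a • e)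
    (P : Derivation k A (Derivation k A A))
    (hP : ∀ a b (e : M), P a b • e =
      (∑ i, ∑ j, q i j * (V i a * V j b + V i a * U j b + U i a * V j b)) • e)
    (a b : A) (e : M) : assocDefect P (liftOf q U V E) a b e = 0 := by
  rw [assocDefect, smul_assoc, hP, sub_eq_zero]
  rw [liftOf_apply, liftOf_apply, liftOf_apply, smul_comm a (2 : k)⁻¹, ← smul_sub, ← smul_add]
  refine congrArg _ ?_
  rw [Finset.sum_smul, Finset.smul_sum, ← Finset.sum_sub_distrib, ← Finset.sum_add_distrib]
  refine Finset.sum_congr rfl fun i _ => ?_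
  rw [Finset.sum_smul, Finset.smul_sum, ← Finset.sum_sub_distrib, ← Finset.sum_add_distrib]
  exact Finset.sum_congr rfl fun j _ => (liftTerm_coboundary (hE i) (hE j) a b e).symm

theorem isDiffOp_liftOf_flip (q : Fin n → Fin n → A) (U V : Fin n → Derivation k A A)
    (E : Fin n → M →ₗ[k] M) (e : M) : IsDiffOp k A 2 ((liftOf q U V E).flip e) := by
  have : (liftOf q U V E).flip e = (2 : k)⁻¹ •
      ∑ i, ∑ j, (liftTerm (q i j) (U i) (V i) (U j) (E i) (E j)).flip e := by
    ext a
    simp [liftOf_apply, LinearMap.sum_apply]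
  rw [this]
  exact .smul _ (.sum _ fun i => .sum _ fun j => isDiffOp_liftTerm_flip _ _ _ _ _ _ e)

theorem isDiffOp_liftOf (hE : ∀ i a e, E i (a • e) = a • E i e + V i a • e) (a : A) :
    IsDiffOp k A 2 (liftOf q U V E a) := by
  have : liftOf q U V E a = (2 : k)⁻¹ •
      ∑ i, ∑ j, liftTerm (q i j) (U i) (V i) (U j) (E i) (E j) a := by
    ext e
    simp [liftOf_apply, LinearMap.sum_apply]
  rw [this]
  exact .smul _ (.sum _ fun i => .sum _ fun j => isDiffOp_liftTerm (hE i) (hE j) a)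

end Lift

/-! ## Associativity and actions -/

section Action

variable {k A M : Type*} [Field k] [CommRing A] [Algebra k A]
  [AddCommGroup M] [Module A M] [Module k M]
  {P : Derivation k A (Derivation k A A)} {α : A →ₗ[k] M →ₗ[k] M}

theorem biderivation_neg (hP : ∀ a, P a a = 0) (a b : A) : P b a = -P a b := by
  have := hP (a + b)
  simp only [map_add, Derivation.add_apply, hP, zero_add, add_zero] at this
  exact eq_neg_of_add_eq_zero_left this

theorem assocDefect_zero_antisymm (h2 : (2 : k) ≠ 0) (hP : ∀ a, P a a = 0) (x y : A) (m : M) :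
    assocDefect P 0 x y m - assocDefect P 0 y x m = P x y • m := by
  simp only [assocDefect, LinearMap.zero_apply, smul_zero, sub_zero, add_zero]
  rw [biderivation_neg hP x y, smul_neg, neg_smul, sub_neg_eq_add, ← add_smul, ← two_smul k,
    smul_inv_smul₀ h2]

theorem mk_fst (P : Derivation k A (Derivation k A A)) (a b : A) : (Quant.mk P a b).1 = a := rfl

theorem mk_snd (P : Derivation k A (Derivation k A A)) (a b : A) : (Quant.mk P a b).2 = b := rfl

/-- From `εb = ε ∗ b` and `a ∗ ε = εa` the action on and by multiples of `ε` is plain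
multiplication. The `ε`-parts of `a(bm)` and `(a ∗ b)m`, with `a ∗ b = ab + ε · ½P(a, b)`, then give
the identity. -/
theorem assocDefect_eq_zero_of_act (f : Quant P →ₐ[k] Module.End k (M × M))
    (hε : ∀ e, f (Quant.mk P 0 1) e = (0, e.1))
    (hα : ∀ a e, f (Quant.mk P a 0) (e, 0) = (a • e, α a e))
    (h1 : ∀ a b e, (f (Quant.mk P a b) e).1 = a • e.1) (a b : A) (m : M) :
    assocDefect P α a b m = 0 := by
  have hb : ∀ b e, f (Quant.mk P 0 b) e = (0, b • e.1) := fun b e => by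
    have h : Quant.mk P 0 b = Quant.mk P 0 1 * Quant.mk P b 0 :=
      Quant.ext' (by simp [Quant.mul_fst, mk_fst]) (by simp [Quant.mul_snd, mk_fst, mk_snd])
    rw [h, map_mul, Module.End.mul_apply, hε, h1]
  have hε' : ∀ a m, f (Quant.mk P a 0) (0, m) = (0, a • m) := fun a m => by
    have h : Quant.mk P a 0 * Quant.mk P 0 1 = Quant.mk P 0 a :=
      Quant.ext' (by simp [Quant.mul_fst, mk_fst]) (by simp [Quant.mul_snd, mk_fst, mk_snd])
    have := congr(f $h (m, 0))
    rwa [map_mul, Module.End.mul_apply, hε, hb] at this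
  have h : Quant.mk P a 0 * Quant.mk P b 0 =
      Quant.mk P (a * b) 0 + Quant.mk P 0 ((2 : k)⁻¹ • P a b) :=
    Quant.ext' (by simp [Quant.mul_fst, Quant.add_fst, mk_fst])
      (by simp [Quant.mul_snd, Quant.add_snd, mk_fst, mk_snd])
  have := congr((f $h (m, 0)).2)
  rw [map_mul, Module.End.mul_apply, hα, map_add, LinearMap.add_apply, hα, hb,
    show ((b • m, α b m) : M × M) = (b • m, 0) + (0, α b m) by simp, map_add, hα, hε'] at this
  simp only [Prod.snd_add] at this
  rw [assocDefect, sub_eq_zero, ← sub_eq_iff_eq_add'.2 this.symm.symm]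
  abel

variable [IsScalarTower k A M]

/-- The outer terms of the coboundary of `α` die because `x` and `y` kill `M`; the middle one is
symmetric. -/
theorem assocDefect_antisymm (I : Ideal A) (hI : ∀ a ∈ I, ∀ m : M, a • m = 0)
    (P : Derivation k A (Derivation k A A)) (α : A →ₗ[k] M →ₗ[k] M) {x y : A} (hx : x ∈ I)
    (hy : y ∈ I) (m : M) :
    assocDefect P α x y m - assocDefect P α y x m =
      assocDefect P 0 x y m - assocDefect P 0 y x m := by
  simp [assocDefect, hI x hx, hI y hy, mul_comm y x]

/-- The action of `A ⊕ εA` on `M ⊕ εM` attached to a lift `α`. -/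
def actOf (h : ∀ a b m, assocDefect P α a b m = 0) : Quant P →ₐ[k] Module.End k (M × M) :=
  have h' : ∀ a b m, ((2 : k)⁻¹ • P a b) • m = a • α b m - α (a * b) m + α a (b • m) :=
    fun a b m => sub_eq_zero.1 (h a b m)
  -- Zero defect at `a = b = 1`, where `P 1 1 = 0`, already forces the unit to act as the identity.
  have h1 : ∀ m, α 1 m = 0 := fun m => by simpa using (h' 1 1 m).symm
  AlgHom.ofLinearMap
    (LinearMap.mk₂ k (fun (x : Quant P) (e : M × M) =>
        (x.1 • e.1, x.1 • e.2 + x.2 • e.1 + α x.1 e.1))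
      (fun x y e => by
        ext
        · simp only [Quant.add_fst, add_smul, Prod.fst_add]
        · simp only [Quant.add_fst, Quant.add_snd, add_smul, Prod.snd_add, map_add,
            LinearMap.add_apply]
          abel)
      (fun c x e => by
        ext
        · simp only [Quant.smul_fst, smul_assoc, Prod.smul_fst]
        · simp only [Quant.smul_fst, Quant.smul_snd, smul_assoc, Prod.smul_snd, map_smul,
            LinearMap.smul_apply, smul_add])
      (fun x e e' => by
        ext
        · simp only [Prod.fst_add, smul_add]
        · simp only [Prod.fst_add, Prod.snd_add, smul_add, map_add]
          abel)
      (fun c x e => by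
        ext
        · simp only [Prod.smul_fst, smul_comm c]
        · simp only [Prod.smul_fst, Prod.smul_snd, smul_add, map_smul, smul_comm c]))
    (by
      ext e <;> simp [Quant.one_fst, Quant.one_snd, h1])
    (fun x y => LinearMap.ext fun e => by
      ext
      · simp [Quant.mul_fst, mul_smul]
      · simp only [Module.End.mul_apply, LinearMap.mk₂_apply, Quant.mul_fst, Quant.mul_snd,
          add_smul, h', smul_add, mul_smul]
        abel)

theorem actOf_apply (h : ∀ a b m, assocDefect P α a b m = 0) (a b : A) (e : M × M) :
    actOf h (Quant.mk P a b) e = (a • e.1, a • e.2 + b • e.1 + α a e.1) := rfl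

end Action

/-! ## Alternating forms on the conormal module -/

section Forms

variable {k A : Type*} [Field k] [CommRing A] [Algebra k A] (I : Ideal A)

theorem altForms_ext {F : Type*} [AddCommGroup F] [Module A F]
    {ω ω' : altForms A I.Cotangent F}
    (h : ∀ x y : I, ω.1 (I.toCotangent x) (I.toCotangent y) =
      ω'.1 (I.toCotangent x) (I.toCotangent y)) : ω = ω' := by
  refine Subtype.ext (LinearMap.ext fun c => LinearMap.ext fun c' => ?_)
  obtain ⟨x, rfl⟩ := I.toCotangent_surjective c
  obtain ⟨y, rfl⟩ := I.toCotangent_surjective c'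
  exact h x y

theorem projForm_apply (P : Derivation k A (Derivation k A A)) (hP : ∀ a, P a a = 0) (x y : I) :
    (projForm I P hP).1 (I.toCotangent x) (I.toCotangent y) = Ideal.Quotient.mk I (P x y) := rfl

theorem projForm_eq_zero_iff (P : Derivation k A (Derivation k A A)) (hP : ∀ a, P a a = 0) :
    projForm I P hP = 0 ↔ ∀ x ∈ I, ∀ y ∈ I, P x y ∈ I := by
  constructor
  · intro h x hx y hy
    rw [← Ideal.Quotient.eq_zero_iff_mem]
    refine (projForm_apply I P hP ⟨x, hx⟩ ⟨y, hy⟩).symm.trans ?_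
    rw [h]
    rfl
  · exact fun h => altForms_ext I fun x y =>
      Ideal.Quotient.eq_zero_iff_mem.2 (h x x.2 y y.2)

variable {M : Type*} [AddCommGroup M] [Module A M] [Module k M] [IsScalarTower k A M]
  (hI : ∀ a ∈ I, ∀ m : M, a • m = 0)

theorem obstrForm_apply_eq (h2 : (2 : k) ≠ 0) (P : Derivation k A (Derivation k A A))
    (hP : ∀ a, P a a = 0) (x y : I) (m : M) :
    (obstrForm I hI P).1 (I.toCotangent x) (I.toCotangent y) m = P x y • m := by
  rw [obstrForm_apply, assocDefect_zero_antisymm h2 hP]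

theorem obstrForm_eq_zero_iff (h2 : (2 : k) ≠ 0) (P : Derivation k A (Derivation k A A))
    (hP : ∀ a, P a a = 0) :
    obstrForm I hI P = 0 ↔ ∀ x ∈ I, ∀ y ∈ I, ∀ m : M, P x y • m = 0 := by
  constructor
  · intro h x hx y hy m
    rw [← obstrForm_apply_eq I hI h2 P hP ⟨x, hx⟩ ⟨y, hy⟩, h]
    rfl
  · exact fun h => altForms_ext I fun x y => LinearMap.ext fun m =>
      (obstrForm_apply_eq I hI h2 P hP x y m).trans (h x x.2 y y.2 m)

theorem obstrForm_eq_scalarForms (h2 : (2 : k) ≠ 0) (P : Derivation k A (Derivation k A A))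
    (hP : ∀ a, P a a = 0) : obstrForm I hI P = scalarForms I hI (projForm I P hP) :=
  altForms_ext I fun x y => LinearMap.ext fun m => by
    rw [obstrForm_apply_eq I hI h2 P hP, scalarForms_apply, projForm_apply]
    rfl

theorem smul_eq_zero_of_scalarForms_eq_zero {ω : altForms A I.Cotangent (A ⧸ I)}
    (h : scalarForms I hI ω = 0) {x y : I} {a : A}
    (ha : ω.1 (I.toCotangent x) (I.toCotangent y) = Ideal.Quotient.mk I a) (m : M) :
    a • m = 0 := by
  have h1 : scalarEnd I hI (ω.1 (I.toCotangent x) (I.toCotangent y)) = 0 := by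
    rw [← scalarForms_apply, h]
    rfl
  rw [ha] at h1
  exact LinearMap.congr_fun h1 m

end Forms

/-! ## Sections of sheaves and vector bundles -/

section Sections

variable {X Y : Scheme.{u}}

theorem section_eq_zero_of_locally (E : Y.Modules) {V : Y.Opens} (e : Γ(E, V))
    (h : ∀ y ∈ V, ∃ (W : Y.Opens) (hW : W ≤ V), y ∈ W ∧ resMod E hW e = 0) : e = 0 := by
  choose W hW hy h0 using h
  refine TopCat.Sheaf.eq_of_locally_eq' (⟨E.presheaf, E.isSheaf⟩ : TopCat.Sheaf Ab Y)
    (fun y : V => W y.1 y.2) V (fun y => homOfLE (hW y.1 y.2)) (fun y hyV => ?_) e 0 fun y => ?_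
  · exact TopologicalSpace.Opens.mem_iSup.2 ⟨⟨y, hyV⟩, hy y hyV⟩
  · exact (h0 y.1 y.2).trans (map_zero _).symm

theorem function_eq_zero_of_locally {V : Y.Opens} (b : Γ(Y, V))
    (h : ∀ y ∈ V, ∃ (W : Y.Opens) (hW : W ≤ V), y ∈ W ∧ res hW b = 0) : b = 0 := by
  choose W hW hy h0 using h
  refine TopCat.Sheaf.eq_of_locally_eq' Y.sheaf
    (fun y : V => W y.1 y.2) V (fun y => homOfLE (hW y.1 y.2)) (fun y hyV => ?_) b 0 fun y => ?_
  · exact TopologicalSpace.Opens.mem_iSup.2 ⟨⟨y, hyV⟩, hy y hyV⟩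
  · exact (h0 y.1 y.2).trans (map_zero _).symm

theorem res_res {U V W : X.Opens} (h : V ≤ U) (h' : W ≤ V) (a : Γ(X, U)) :
    res h' (res h a) = res (h'.trans h) a := by
  have := congr($(X.presheaf.map_comp (homOfLE h).op (homOfLE h').op).hom a)
  exact this.symm

theorem resMod_resMod (E : Y.Modules) {U V W : Y.Opens} (h : V ≤ U) (h' : W ≤ V) (e : Γ(E, U)) :
    resMod E h' (resMod E h e) = resMod E (h'.trans h) e := by
  have := congr($(E.presheaf.map_comp (homOfLE h).op (homOfLE h').op).hom e)
  exact this.symm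

theorem resMod_smul (E : Y.Modules) {V W : Y.Opens} (h : W ≤ V) (b : Γ(Y, V)) (e : Γ(E, V)) :
    resMod E h (b • e) = res h b • resMod E h e :=
  Scheme.Modules.map_smul E (homOfLE h) b e

theorem preimage_le (i : Y ⟶ X) {V W : X.Opens} (h : W ≤ V) : i ⁻¹ᵁ W ≤ i ⁻¹ᵁ V :=
  fun _ hy => h hy

theorem app_res (i : Y ⟶ X) {V W : X.Opens} (h : W ≤ V) (a : Γ(X, V)) :
    (i.app W).hom (res h a) = res (preimage_le i h) ((i.app V).hom a) := by
  have := congr($(i.naturality (homOfLE h).op).hom a)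
  exact this

/-- Sections of a module over `V` that are a basis of the sections over every open `W ≤ V`. -/
def IsFrame (E : Y.Modules) {V : Y.Opens} {n : ℕ} (e : Fin n → Γ(E, V)) : Prop :=
  ∀ (W : Y.Opens) (h : W ≤ V),
    Function.Bijective fun c : Fin n → Γ(Y, W) => ∑ j, c j • resMod E h (e j)

theorem IsFrame.restrict {E : Y.Modules} {V V' : Y.Opens} (h : V' ≤ V) {n : ℕ}
    {e : Fin n → Γ(E, V)} (he : IsFrame E e) : IsFrame E fun j => resMod E h (e j) := by
  intro W hW
  simp only [resMod_resMod]
  exact he W (hW.trans h)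

/-- A closed subscheme is covered by affine open subsets of the ambient scheme over which a given
vector bundle has a frame and is faithful. -/
theorem exists_frame (i : Y ⟶ X) [IsClosedImmersion i] {E : Y.Modules} (hE : IsVectorBundle E)
    (W : X.Opens) (p : X) (hp : p ∈ W) :
    ∃ U : X.affineOpens, p ∈ U.1 ∧ U.1 ≤ W ∧
      (∃ (n : ℕ) (e : Fin n → Γ(E, i ⁻¹ᵁ U.1)), IsFrame E e) ∧
      ∀ b : Γ(Y, i ⁻¹ᵁ U.1), (∀ m : Γ(E, i ⁻¹ᵁ U.1), b • m = 0) → b = 0 := by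
  have hB : ∀ {U : X.Opens} {x : X}, x ∈ U → ∃ U' ∈ X.affineOpens, x ∈ U' ∧ U' ≤ U :=
    TopologicalSpace.Opens.isBasis_iff_nbhd.1 X.isBasis_affineOpens
  by_cases hpY : p ∈ Set.range i
  · obtain ⟨y, rfl⟩ := hpY
    obtain ⟨V, hyV, n, hn, e, he⟩ := hE y
    obtain ⟨O, hO, hOV⟩ := i.isClosedEmbedding.isInducing.isOpen_iff.1 V.2
    obtain ⟨U, hU, hpU, hUW⟩ := hB (U := ⟨O, hO⟩ ⊓ W) (x := i y)
      ⟨by change y ∈ i ⁻¹' O; rw [hOV]; exact hyV, hp⟩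
    have hUV : i ⁻¹ᵁ U ≤ V := fun z hz => by
      have : z ∈ i ⁻¹' O := (hUW hz).1
      rwa [hOV] at this
    have he' := IsFrame.restrict hUV he
    refine ⟨⟨U, hU⟩, hpU, hUW.trans inf_le_right, ⟨n, _, he'⟩, fun b hb => ?_⟩
    -- Positive rank enters here: `b` times the first frame member is zero, so uniqueness of
    -- coordinates gives `b = 0`.
    have := (he _ hUV).1 (a₁ := fun j => if j = ⟨0, hn⟩ then b else 0) (a₂ := 0)
      (by simp [ite_smul, hb])
    simpa using congrFun this ⟨0, hn⟩
  · obtain ⟨U, hU, hpU, hUW⟩ := hB (U := ⟨(Set.range i)ᶜ,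
      i.isClosedEmbedding.isClosed_range.isOpen_compl⟩ ⊓ W) (x := p) ⟨hpY, hp⟩
    have hUY : ∀ z, z ∉ i ⁻¹ᵁ U := fun z hz => (hUW hz).1 ⟨z, rfl⟩
    -- Away from `Y` the preimage of `U` is empty, so all sections vanish and the empty family is a
    -- frame.
    refine ⟨⟨U, hU⟩, hpU, hUW.trans inf_le_right, ⟨0, fun j => j.elim0, fun W hW => ?_⟩,
      fun b _ => function_eq_zero_of_locally b fun z hz => (hUY z hz).elim⟩
    have h0 : ∀ m : Γ(E, W), m = 0 := fun m =>
      section_eq_zero_of_locally E m fun z hz => (hUY z (hW hz)).elim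
    exact ⟨fun _ _ _ => funext fun j => j.elim0, fun m => ⟨fun j => j.elim0, by simp [h0 m]⟩⟩

end Sections

/-! ### The obstruction section: independence of the lift, injectivity, necessity -/

section Obstruction

variable {k : Type u} [Field k] {X Y : Scheme.{u}} [X.Over (Spec (.of k))] (i : Y ⟶ X)

theorem wedgeN_ext {ω ω' : wedgeN i} (h : ∀ V, ω.1 V = ω'.1 V) : ω = ω' :=
  Subtype.ext (funext h)

theorem wedgeNEnd_ext {E : Y.Modules} {ω ω' : wedgeNEnd i E} (h : ∀ V, ω.1 V = ω'.1 V) : ω = ω' :=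
  Subtype.ext (funext h)

theorem obstruction_apply (h2 : (2 : k) ≠ 0) (E : Y.Modules) (P : Bivector k X)
    (V : X.affineOpens) {x y : Γ(X, V)} (hx : x ∈ idealOf i V.1) (hy : y ∈ idealOf i V.1)
    (e : Γ(push i E, V)) :
    ((obstruction i E P).1 V).1 (conormal i V.1 x hx) (conormal i V.1 y hy) e =
      P.der V x y • e :=
  assocDefect_zero_antisymm h2 (P.alt V) x y e

theorem obstruction_apply_lift (E : Y.Modules) (P : Bivector k X) (V : X.affineOpens)
    (α : Γ(X, V) →ₗ[k] Γ(push i E, V) →ₗ[k] Γ(push i E, V)) {x y : Γ(X, V)}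
    (hx : x ∈ idealOf i V.1) (hy : y ∈ idealOf i V.1) (e : Γ(push i E, V)) :
    ((obstruction i E P).1 V).1 (conormal i V.1 x hx) (conormal i V.1 y hy) e =
      assocDefect (P.der V) α x y e - assocDefect (P.der V) α y x e :=
  (assocDefect_antisymm (idealOf i V.1) (idealOf_smul i E V.1) (P.der V) α hx hy e).symm

theorem obstruction_eq_zero_iff (h2 : (2 : k) ≠ 0) (E : Y.Modules) (P : Bivector k X)
    (V : X.affineOpens) : (obstruction i E P).1 V = 0 ↔
      ∀ x ∈ idealOf i V.1, ∀ y ∈ idealOf i V.1, ∀ e : Γ(push i E, V), P.der V x y • e = 0 :=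
  obstrForm_eq_zero_iff (idealOf i V.1) (idealOf_smul i E V.1) h2 (P.der V) (P.alt V)

theorem obstruction_eq_inclusion (h2 : (2 : k) ≠ 0) (E : Y.Modules) (P : Bivector k X) :
    obstruction i E P = inclusion i E (proj i P) :=
  wedgeNEnd_ext i fun V => obstrForm_eq_scalarForms (idealOf i V.1) (idealOf_smul i E V.1) h2
    (P.der V) (P.alt V)

theorem mem_idealOf_of_locally {V : X.Opens} {a : Γ(X, V)}
    (h : ∀ p ∈ V, ∃ (W : X.Opens) (hW : W ≤ V), p ∈ W ∧ res hW a ∈ idealOf i W) :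
    a ∈ idealOf i V := by
  refine function_eq_zero_of_locally _ fun y hy => ?_
  obtain ⟨W, hW, hyW, ha⟩ := h (i y) hy
  exact ⟨i ⁻¹ᵁ W, preimage_le i hW, hyW, (app_res i hW a).symm.trans ha⟩

theorem scalarForms_eq_zero_of_inclusion_eq_zero {E : Y.Modules} {ω : wedgeN i}
    (hω : inclusion i E ω = 0) (V : X.affineOpens) :
    scalarForms (idealOf i V.1) (idealOf_smul i E V.1) (ω.1 V) = 0 :=
  congrFun (congrArg Subtype.val hω) V

/-- On a small affine `U` where `E` is faithful, the value of `ω`, restricted to `U`, kills `E` and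
so vanishes; membership in the ideal of `Y` is local. -/
theorem wedgeN_apply_eq_zero [IsClosedImmersion i] {E : Y.Modules} (hE : IsVectorBundle E)
    {ω : wedgeN i}
    (h : ∀ V : X.affineOpens, scalarForms (idealOf i V.1) (idealOf_smul i E V.1) (ω.1 V) = 0)
    (V : X.affineOpens) {x y a : Γ(X, V)} (hx : x ∈ idealOf i V.1) (hy : y ∈ idealOf i V.1)
    (ha : Ideal.Quotient.mk (idealOf i V.1) a =
      (ω.1 V).1 (conormal i V.1 x hx) (conormal i V.1 y hy)) : a ∈ idealOf i V.1 := by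
  refine mem_idealOf_of_locally i fun p hp => ?_
  obtain ⟨U, hpU, hUV, -, hf⟩ := exists_frame i hE V.1 p hp
  refine ⟨U.1, hUV, hpU, hf _ fun m => ?_⟩
  have h1 := ω.2 V U hUV x y hx hy
  exact smul_eq_zero_of_scalarForms_eq_zero (idealOf i U.1) (idealOf_smul i E U.1) (h U)
    (a := res hUV a) (h1.trans (by rw [← ha]; rfl)) m

theorem wedgeN_eq_zero [IsClosedImmersion i] {E : Y.Modules} (hE : IsVectorBundle E)
    {ω : wedgeN i}
    (h : ∀ V : X.affineOpens, scalarForms (idealOf i V.1) (idealOf_smul i E V.1) (ω.1 V) = 0)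
    (V : X.affineOpens) : ω.1 V = 0 := by
  refine altForms_ext (idealOf i V.1) fun x y => ?_
  obtain ⟨a, ha⟩ := Ideal.Quotient.mk_surjective
    ((ω.1 V).1 (conormal i V.1 x x.2) (conormal i V.1 y y.2))
  exact ha.symm.trans (Ideal.Quotient.eq_zero_iff_mem.2 (wedgeN_apply_eq_zero i hE
    h V x.2 y.2 ha))

theorem inclusion_injective [IsClosedImmersion i] {E : Y.Modules} (hE : IsVectorBundle E) :
    Function.Injective (inclusion i E) :=
  (injective_iff_map_eq_zero (inclusion i E)).2 fun _ hω =>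
    wedgeN_ext i (wedgeN_eq_zero i hE (scalarForms_eq_zero_of_inclusion_eq_zero i hω))

theorem proj_eq_zero_iff (P : Bivector k X) : proj i P = 0 ↔ IsCoisotropic P i := by
  rw [Subtype.ext_iff, funext_iff]
  exact forall_congr' fun V => projForm_eq_zero_iff (idealOf i V.1) (P.der V) (P.alt V)

variable {i}

theorem FirstOrderDeformation.der_smul_eq_zero (h2 : (2 : k) ≠ 0) {P : Bivector k X}
    {E : Y.Modules} {U : X.affineOpens} (δ : FirstOrderDeformation i P E U) (V : X.affineOpens)
    (hV : V.1 ≤ U.1) {x y : Γ(X, V)} (hx : x ∈ idealOf i V.1) (hy : y ∈ idealOf i V.1)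
    (e : Γ(push i E, V)) : P.der V x y • e = 0 := by
  obtain ⟨n, h⟩ := δ.bidiff
  obtain ⟨α, hα, -⟩ := h V hV
  have hd := assocDefect_eq_zero_of_act (δ.act V hV) (δ.act_eps V hV) hα (δ.act_fst V hV)
  rw [← obstruction_apply i h2 E P V hx hy, obstruction_apply_lift i E P V α hx hy, hd, hd,
    sub_zero]

theorem LocallyDeformable.obstruction_eq_zero (h2 : (2 : k) ≠ 0) {P : Bivector k X}
    {E : Y.Modules} {W : X.Opens} (h : LocallyDeformable i P E W) (V : X.affineOpens)
    (hV : V.1 ≤ W) : (obstruction i E P).1 V = 0 := by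
  rw [obstruction_eq_zero_iff i h2]
  intro x hx y hy e
  refine section_eq_zero_of_locally E _ fun p hp => ?_
  obtain ⟨U, hpU, -, ⟨δ⟩⟩ := h (i p) (hV hp)
  obtain ⟨V', hV', hpV', hle⟩ := TopologicalSpace.Opens.isBasis_iff_nbhd.1 X.isBasis_affineOpens
    (U := V.1 ⊓ U.1) (x := i p) ⟨hp, hpU⟩
  have hV'V : V' ≤ V.1 := hle.trans inf_le_left
  refine ⟨i ⁻¹ᵁ V', preimage_le i hV'V, hpV', ?_⟩
  have h1 := δ.der_smul_eq_zero h2 ⟨V', hV'⟩ (hle.trans inf_le_right) (idealOf_res i hV'V hx)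
    (idealOf_res i hV'V hy) (resMod (push i E) hV'V e)
  rw [← P.map V ⟨V', hV'⟩ hV'V] at h1
  exact (resMod_smul (push i E) hV'V _ e).trans h1

end Obstruction

/-! ## Extension of derivations to smaller affine opens -/

section Extend

variable {k : Type u} [Field k] {X Y : Scheme.{u}} [X.Over (Spec (.of k))]

theorem smooth_sections [Smooth (X ↘ Spec (.of k))] (U : X.affineOpens) :
    Algebra.Smooth k Γ(X, U) := by
  have h := (X ↘ Spec (.of k)).smooth_appLE (isAffineOpen_top _) U.2 (V := U.1) le_top
  have h' := RingHom.Smooth.respectsIso.2 _ (Scheme.ΓSpecIso (.of k)).symm.commRingCatIsoToRingEquiv h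
  exact h'

theorem etale_res {U V : X.affineOpens} (h : V.1 ≤ U.1) :
    (X.presheaf.map (homOfLE h).op).hom.Etale := by
  -- Restriction is the map on sections of the étale morphism `𝟙 X`.
  have e : (𝟙 X : X ⟶ X).appLE U.1 V.1 h = X.presheaf.map (homOfLE h).op := by
    change (𝟙 X : X ⟶ X).app U.1 ≫ X.presheaf.map _ = _
    rw [Scheme.Hom.id_app]
    exact Category.id_comp _
  exact e ▸ (𝟙 X : X ⟶ X).etale_appLE U.2 V.2 h

theorem derivation_ext_of_res {U V : X.affineOpens} (h : V.1 ≤ U.1) {M : Type*} [AddCommGroup M]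
    [Module k M] [Module Γ(X, V) M] [IsScalarTower k Γ(X, V) M] {D D' : Derivation k Γ(X, V) M}
    (hD : ∀ a : Γ(X, U), D (res h a) = D' (res h a)) : D = D' := by
  let : Algebra Γ(X, U) Γ(X, V) := (X.presheaf.map (homOfLE h).op).hom.toAlgebra
  have : Algebra.Etale Γ(X, U) Γ(X, V) := etale_res h
  exact derivation_ext_of_formallyUnramified hD

theorem exists_derivation_extension {U V : X.affineOpens} (h : V.1 ≤ U.1)
    (D : Derivation k Γ(X, U) Γ(X, U)) :
    ∃ D' : Derivation k Γ(X, V) Γ(X, V), ∀ a, D' (res h a) = res h (D a) := by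
  let : Algebra Γ(X, U) Γ(X, V) := (X.presheaf.map (homOfLE h).op).hom.toAlgebra
  have : Algebra.Etale Γ(X, U) Γ(X, V) := etale_res h
  have : IsScalarTower k Γ(X, U) Γ(X, V) :=
    IsScalarTower.of_algebraMap_eq fun c => (res_algebraMap h c).symm
  exact ⟨extendDerivation Γ(X, V) D, extendDerivation_algebraMap D⟩

/-- The extension of a derivation of the functions on `U` to a smaller affine open `V`. -/
def resDer {U V : X.affineOpens} (h : V.1 ≤ U.1) (D : Derivation k Γ(X, U) Γ(X, U)) :
    Derivation k Γ(X, V) Γ(X, V) :=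
  (exists_derivation_extension h D).choose

theorem resDer_res {U V : X.affineOpens} (h : V.1 ≤ U.1) (D : Derivation k Γ(X, U) Γ(X, U))
    (a : Γ(X, U)) : resDer h D (res h a) = res h (D a) :=
  (exists_derivation_extension h D).choose_spec a

/-- Both sides are derivations from functions on `V` to functions on `W` that agree on functions
coming from `U`; uniqueness also makes the choice in `resDer` harmless. -/
theorem res_resDer {U V W : X.affineOpens} (h : V.1 ≤ U.1) (h' : W.1 ≤ V.1)
    (D : Derivation k Γ(X, U) Γ(X, U)) (a : Γ(X, V)) :
    resDer (h'.trans h) D (res h' a) = res h' (resDer h D a) := by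
  let : Algebra Γ(X, V) Γ(X, W) := (X.presheaf.map (homOfLE h').op).hom.toAlgebra
  have : IsScalarTower k Γ(X, V) Γ(X, W) :=
    IsScalarTower.of_algebraMap_eq fun c => (res_algebraMap h' c).symm
  have := derivation_ext_of_res h (D := (resDer (h'.trans h) D).compAlgebraMap Γ(X, V))
    (D' := (Algebra.linearMap Γ(X, V) Γ(X, W)).compDer (resDer h D)) fun b => by
      change resDer (h'.trans h) D (res h' (res h b)) = res h' (resDer h D (res h b))
      rw [res_res, resDer_res, resDer_res, res_res]
  exact congr($this a)

end Extend

/-! ## Connections -/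

section Nabla

variable {k : Type u} [Field k] {Y : Scheme.{u}} [Y.Over (Spec (.of k))]
  {E : Y.Modules} {V : Y.Opens} {n : ℕ} {e : Fin n → Γ(E, V)}

theorem resMod_sum (E : Y.Modules) {V W : Y.Opens} (h : W ≤ V) {ι : Type*} (s : Finset ι)
    (m : ι → Γ(E, V)) : resMod E h (∑ j ∈ s, m j) = ∑ j ∈ s, resMod E h (m j) :=
  map_sum (E.presheaf.map (homOfLE h).op).hom m s

/-- The coordinates of sections with respect to a frame. -/
def IsFrame.coord (he : IsFrame E e) {W : Y.Opens} (h : W ≤ V) :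
    Γ(E, W) ≃ₗ[Γ(Y, W)] (Fin n → Γ(Y, W)) :=
  (LinearEquiv.ofBijective (Fintype.linearCombination Γ(Y, W) fun j => resMod E h (e j))
    (he W h)).symm

theorem IsFrame.sum_coord (he : IsFrame E e) {W : Y.Opens} (h : W ≤ V) (m : Γ(E, W)) :
    ∑ j, he.coord h m j • resMod E h (e j) = m :=
  (he.coord h).symm_apply_apply m

theorem IsFrame.coord_sum (he : IsFrame E e) {W : Y.Opens} (h : W ≤ V) (c : Fin n → Γ(Y, W)) :
    he.coord h (∑ j, c j • resMod E h (e j)) = c :=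
  (he.coord h).apply_symm_apply c

theorem IsFrame.coord_res (he : IsFrame E e) {W W' : Y.Opens} (h : W ≤ V) (h' : W' ≤ W)
    (m : Γ(E, W)) (j : Fin n) :
    he.coord (h'.trans h) (resMod E h' m) j = res h' (he.coord h m j) := by
  conv_lhs => rw [← he.sum_coord h m, resMod_sum]
  simp only [resMod_smul, resMod_resMod]
  exact congrFun (he.coord_sum (h'.trans h) _) j

/-- The connection along a derivation for which the members of a frame are flat. -/
def IsFrame.nabla (he : IsFrame E e) {W : Y.Opens} (h : W ≤ V) (w : Derivation k Γ(Y, W) Γ(Y, W))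
    (m : Γ(E, W)) : Γ(E, W) :=
  ∑ j, w (he.coord h m j) • resMod E h (e j)

theorem IsFrame.nabla_add (he : IsFrame E e) {W : Y.Opens} (h : W ≤ V)
    (w : Derivation k Γ(Y, W) Γ(Y, W)) (m m' : Γ(E, W)) :
    he.nabla h w (m + m') = he.nabla h w m + he.nabla h w m' := by
  simp only [nabla, map_add, Pi.add_apply, add_smul, Finset.sum_add_distrib]

theorem IsFrame.nabla_smul (he : IsFrame E e) {W : Y.Opens} (h : W ≤ V)
    (w : Derivation k Γ(Y, W) Γ(Y, W)) (b : Γ(Y, W)) (m : Γ(E, W)) :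
    he.nabla h w (b • m) = b • he.nabla h w m + w b • m := by
  conv_rhs => rw [← he.sum_coord h m]
  simp only [nabla, map_smul, he.coord_sum, Pi.smul_apply, smul_eq_mul, Derivation.leibniz,
    add_smul, Finset.sum_add_distrib, Finset.smul_sum, mul_smul, smul_comm (w b)]

theorem IsFrame.nabla_res (he : IsFrame E e) {U W W' : Y.affineOpens} (hU : W.1 ≤ U.1)
    (h : W.1 ≤ V) (h' : W'.1 ≤ W.1) (w : Derivation k Γ(Y, U) Γ(Y, U)) (m : Γ(E, W)) :
    he.nabla (h'.trans h) (resDer (h'.trans hU) w) (resMod E h' m) =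
      resMod E h' (he.nabla h (resDer hU w) m) := by
  rw [nabla, nabla, resMod_sum]
  refine Finset.sum_congr rfl fun j _ => ?_
  rw [resMod_smul, resMod_resMod, he.coord_res h h', res_resDer hU h']

end Nabla

/-! ## Biderivations that are sums of products of derivations -/

section Products

variable {k A : Type*} [Field k] [CommRing A] [Algebra k A]

/-- The biderivation `(a, b) ↦ D a · D' b`. -/
def mulDer (D D' : Derivation k A A) : Derivation k A (Derivation k A A) :=
  (LinearMap.toSpanSingleton A (Derivation k A A) D').compDer D

/-- The biderivation `∑ pᵢⱼ (vᵢ ⊗ vⱼ + vᵢ ⊗ uⱼ + uᵢ ⊗ vⱼ)`. -/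
def sumDer {n : ℕ} (p : Fin n → Fin n → A) (u v : Fin n → Derivation k A A) :
    Derivation k A (Derivation k A A) :=
  ∑ i, ∑ j, p i j • (mulDer (v i) (v j) + mulDer (v i) (u j) + mulDer (u i) (v j))

theorem sumDer_apply {n : ℕ} (p : Fin n → Fin n → A) (u v : Fin n → Derivation k A A) (a b : A) :
    sumDer p u v a b = ∑ i, ∑ j, p i j * (v i a * v j b + v i a * u j b + u i a * v j b) := by
  let ev : Derivation k A (Derivation k A A) →+ A :=
    { toFun := fun D => D a b, map_zero' := rfl, map_add' := fun _ _ => rfl }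
  change ev _ = _
  simp only [sumDer, map_sum]
  rfl

variable {A' M M' : Type*} [CommRing A'] [Algebra k A'] [AddCommGroup M] [Module A M] [Module k M]
  [IsScalarTower k A M] [AddCommGroup M'] [Module A' M'] [Module k M'] [IsScalarTower k A' M']

/-- The lift is an algebraic expression in `p`, `u`, `v`, `D`, hence natural; with restriction maps
for `φ` and `ψ` this makes the lifts compatible with restriction. -/
theorem liftOf_map (φ : A →+* A') (ψ : M →ₗ[k] M') (hψ : ∀ a m, ψ (a • m) = φ a • ψ m) {n : ℕ}
    (p : Fin n → Fin n → A) {u v : Fin n → Derivation k A A} {D : Fin n → M →ₗ[k] M}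
    {u' v' : Fin n → Derivation k A' A'} {D' : Fin n → M' →ₗ[k] M'}
    (hu : ∀ i a, u' i (φ a) = φ (u i a)) (hv : ∀ i a, v' i (φ a) = φ (v i a))
    (hD : ∀ i m, D' i (ψ m) = ψ (D i m)) (a : A) (m : M) :
    liftOf (fun i j => φ (p i j)) u' v' D' (φ a) (ψ m) = ψ (liftOf p u v D a m) := by
  simp only [liftOf_apply, liftTerm_apply, map_smul, map_sum, map_sub, hψ, hu, hv, hD, map_add]

end Products

/-! ## Derivations along a closed subscheme -/

section Preimage

variable {k : Type u} [Field k] {X Y : Scheme.{u}} [Y.Over (Spec (.of k))]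
  (i : Y ⟶ X) [IsClosedImmersion i]

/-- The affine open subset `U ∩ Y` of `Y`. -/
def affinePreimage (U : X.affineOpens) : Y.affineOpens :=
  ⟨i ⁻¹ᵁ U.1, U.2.preimage i⟩

variable {U V : X.affineOpens} (h : V.1 ≤ U.1)

/-- The extension of a derivation of the functions on `U ∩ Y` to `V ∩ Y`. -/
def resDerPreimage (w : Derivation k Γ(Y, i ⁻¹ᵁ U.1) Γ(Y, i ⁻¹ᵁ U.1)) :
    Derivation k Γ(Y, i ⁻¹ᵁ V.1) Γ(Y, i ⁻¹ᵁ V.1) :=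
  resDer (U := affinePreimage i U) (V := affinePreimage i V) (preimage_le i h) w

theorem resDerPreimage_res (w : Derivation k Γ(Y, i ⁻¹ᵁ U.1) Γ(Y, i ⁻¹ᵁ U.1))
    (b : Γ(Y, i ⁻¹ᵁ U.1)) :
    resDerPreimage i h w (res (preimage_le i h) b) = res (preimage_le i h) (w b) :=
  resDer_res (U := affinePreimage i U) (V := affinePreimage i V) (preimage_le i h) w b

end Preimage

/-! ### Construction of a deformation over an affine open with a frame -/

section Closed

variable {k : Type u} [Field k] {X Y : Scheme.{u}} [X.Over (Spec (.of k))]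

/-- Uniqueness of extensions is applied in one argument at a time, the other argument first being
restricted from `U`. -/
theorem biderivation_ext_of_res {U V : X.affineOpens} (h : V.1 ≤ U.1) {N : Type*} [AddCommGroup N]
    [Module k N] [Module Γ(X, V) N] [IsScalarTower k Γ(X, V) N] (f : Γ(X, V) →ₗ[Γ(X, V)] N)
    {P Q : Derivation k Γ(X, V) (Derivation k Γ(X, V) Γ(X, V))}
    (hPQ : ∀ a b : Γ(X, U), f (P (res h a) (res h b)) = f (Q (res h a) (res h b)))
    (a b : Γ(X, V)) : f (P a b) = f (Q a b) := by
  let ev (b : Γ(X, V)) : Derivation k Γ(X, V) Γ(X, V) →ₗ[Γ(X, V)] Γ(X, V) :=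
    { toFun := fun D => D b, map_add' := fun _ _ => rfl, map_smul' := fun _ _ => rfl }
  have h1 (b : Γ(X, U)) : (f ∘ₗ ev (res h b)).compDer P = (f ∘ₗ ev (res h b)).compDer Q :=
    derivation_ext_of_res h fun a => hPQ a b
  have h2 : f.compDer (P a) = f.compDer (Q a) :=
    derivation_ext_of_res h fun b => congr($(h1 b) a)
  exact congr($h2 b)

theorem resMod_smul_field (M : X.Modules) {V W : X.Opens} (h : W ≤ V) (c : k) (m : Γ(M, V)) :
    resMod M h (c • m) = c • resMod M h m :=
  (resMod_smul M h (algebraMap k _ c) m).trans (by rw [res_algebraMap]; rfl)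

theorem smul_eq_smul_of_app_eq (i : Y ⟶ X) (E : Y.Modules) {V : X.Opens} {a b : Γ(X, V)}
    (hab : (i.app V).hom a = (i.app V).hom b) (m : Γ(push i E, V)) : a • m = b • m := by
  rw [← sub_eq_zero, ← sub_smul]
  refine idealOf_smul i E V _ ?_ m
  rw [idealOf, RingHom.mem_ker, map_sub, hab, sub_self]

variable [Y.Over (Spec (.of k))] (i : Y ⟶ X) [i.IsOver (Spec (.of k))]

theorem app_algebraMap (V : X.Opens) (c : k) :
    (i.app V).hom (algebraMap k Γ(X, V) c) = algebraMap k Γ(Y, i ⁻¹ᵁ V) c := by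
  have h := Scheme.Hom.appLE_comp_appLE i (X ↘ Spec (.of k)) ⊤ V (i ⁻¹ᵁ V) le_top le_rfl
  simp only [comp_over] at h
  rw [Scheme.Hom.appLE_eq_app] at h
  exact congr($(h).hom ((Scheme.ΓSpecIso (.of k)).inv.hom c))

/-- Restriction of functions to a closed subscheme makes them into an algebra. -/
abbrev appAlgebra (V : X.Opens) : Algebra Γ(X, V) Γ(Y, i ⁻¹ᵁ V) := (i.app V).hom.toAlgebra

theorem appAlgebra_isScalarTower (V : X.Opens) :
    letI := appAlgebra i V
    IsScalarTower k Γ(X, V) Γ(Y, i ⁻¹ᵁ V) :=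
  letI := appAlgebra i V
  IsScalarTower.of_algebraMap_eq fun c => (app_algebraMap i V c).symm

/-- The decomposition is chosen only over `U`. Over `V` both sides are biderivations with values in
functions on `V ∩ Y`, so agreement on functions from `U` suffices. -/
theorem sumDer_res {U V : X.affineOpens} (h : V.1 ≤ U.1) {P : Bivector k X} {n : ℕ} {p : Fin n → Fin n → Γ(X, U)}
    {u v : Fin n → Derivation k Γ(X, U) Γ(X, U)}
    (hP : ∀ a b, (i.app U.1).hom (P.der U a b) = (i.app U.1).hom (sumDer p u v a b))
    (a b : Γ(X, V)) : (i.app V.1).hom (P.der V a b) = (i.app V.1).hom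
      (sumDer (fun i j => res h (p i j)) (fun i => resDer h (u i)) (fun i => resDer h (v i)) a b) := by
  let := appAlgebra i V.1
  have := appAlgebra_isScalarTower (k := k) i V.1
  refine biderivation_ext_of_res h (Algebra.linearMap Γ(X, V) Γ(Y, i ⁻¹ᵁ V.1)) (fun a b => ?_) a b
  change (i.app V.1).hom _ = (i.app V.1).hom _
  have h1 : sumDer (fun i j => res h (p i j)) (fun i => resDer h (u i)) (fun i => resDer h (v i))
      (res h a) (res h b) = res h (sumDer p u v a b) := by
    simp only [sumDer_apply, resDer_res, map_sum, map_mul, map_add]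
  rw [h1, ← P.map U V h, app_res, app_res, hP]

variable [IsClosedImmersion i]

theorem exists_decomposition_of_smooth [Smooth (X ↘ Spec (.of k))] [Smooth (Y ↘ Spec (.of k))]
    (U : X.affineOpens) (P : Derivation k Γ(X, U) (Derivation k Γ(X, U) Γ(X, U)))
    (hP : ∀ x ∈ idealOf i U.1, ∀ y ∈ idealOf i U.1, P x y ∈ idealOf i U.1) :
    ∃ (n : ℕ) (p : Fin n → Fin n → Γ(X, U)) (u v : Fin n → Derivation k Γ(X, U) Γ(X, U))
      (w : Fin n → Derivation k Γ(Y, i ⁻¹ᵁ U.1) Γ(Y, i ⁻¹ᵁ U.1)),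
      (∀ j a, w j ((i.app U.1).hom a) = (i.app U.1).hom (v j a)) ∧
      ∀ a b, (i.app U.1).hom (P a b) = (i.app U.1).hom (sumDer p u v a b) := by
  let := appAlgebra i U.1
  have := appAlgebra_isScalarTower (k := k) i U.1
  have : Algebra.Smooth k Γ(X, U) := smooth_sections U
  have : Algebra.Smooth k Γ(Y, i ⁻¹ᵁ U.1) := smooth_sections (affinePreimage i U)
  obtain ⟨n, p, u, v, w, hw, h⟩ := exists_decomposition (B := Γ(Y, i ⁻¹ᵁ U.1))
    (i.app_surjective U.1 U.2) P fun x y hx hy => hP x hx y hy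
  refine ⟨n, p, u, v, w, hw, fun a b => ?_⟩
  rw [sumDer_apply]
  exact h a b

variable {U V : X.affineOpens} (h : V.1 ≤ U.1)

theorem resDer_app {v : Derivation k Γ(X, U) Γ(X, U)}
    {w : Derivation k Γ(Y, i ⁻¹ᵁ U.1) Γ(Y, i ⁻¹ᵁ U.1)}
    (hw : ∀ a, w ((i.app U.1).hom a) = (i.app U.1).hom (v a)) (a : Γ(X, V)) :
    resDerPreimage i h w ((i.app V.1).hom a) = (i.app V.1).hom (resDer h v a) := by
  let := appAlgebra i V.1
  have := appAlgebra_isScalarTower (k := k) i V.1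
  have := derivation_ext_of_res h (M := Γ(Y, i ⁻¹ᵁ V.1))
    (D := (resDerPreimage i h w).compAlgebraMap Γ(X, V))
    (D' := (Algebra.linearMap Γ(X, V) Γ(Y, i ⁻¹ᵁ V.1)).compDer (resDer h v)) fun b => by
      change resDerPreimage i h w ((i.app V.1).hom (res h b)) =
        (i.app V.1).hom (resDer h v (res h b))
      rw [resDer_res, app_res, app_res, ← hw, resDerPreimage_res]
  exact congr($this a)

/-- The connection on `E|_V` along a derivation of the functions on `U ∩ Y ⊇ V ∩ Y` for which the
members of a frame are flat. -/
def nablaLin {E : Y.Modules} {n : ℕ} {e : Fin n → Γ(E, i ⁻¹ᵁ U.1)} (he : IsFrame E e)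
    {v : Derivation k Γ(X, U) Γ(X, U)} {w : Derivation k Γ(Y, i ⁻¹ᵁ U.1) Γ(Y, i ⁻¹ᵁ U.1)}
    (hw : ∀ a, w ((i.app U.1).hom a) = (i.app U.1).hom (v a)) :
    Γ(push i E, V) →ₗ[k] Γ(push i E, V) :=
  -- Scalars act through `𝒪_X(V)`, so linearity is the Leibniz rule with the derivative of a
  -- constant equal to zero.
  have hsmul (c : k) (m : Γ(E, i ⁻¹ᵁ V.1)) : he.nabla (preimage_le i h) (resDerPreimage i h w)
      ((i.app V.1).hom (algebraMap k Γ(X, V) c) • m) =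
        (i.app V.1).hom (algebraMap k Γ(X, V) c) •
          he.nabla (preimage_le i h) (resDerPreimage i h w) m := by
    rw [he.nabla_smul, resDer_app i h hw, Derivation.map_algebraMap, map_zero, zero_smul, add_zero]
  { toFun := fun m => he.nabla (preimage_le i h) (resDerPreimage i h w) m
    map_add' := fun m m' => he.nabla_add _ _ m m'
    map_smul' := hsmul }

theorem nablaLin_smul {E : Y.Modules} {n : ℕ} {e : Fin n → Γ(E, i ⁻¹ᵁ U.1)} (he : IsFrame E e)
    {v : Derivation k Γ(X, U) Γ(X, U)} {w : Derivation k Γ(Y, i ⁻¹ᵁ U.1) Γ(Y, i ⁻¹ᵁ U.1)}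
    (hw : ∀ a, w ((i.app U.1).hom a) = (i.app U.1).hom (v a)) (a : Γ(X, V))
    (m : Γ(push i E, V)) :
    nablaLin i h he hw (a • m) = a • nablaLin i h he hw m + resDer h v a • m := by
  refine (he.nabla_smul (preimage_le i h) (resDerPreimage i h w) ((i.app V.1).hom a) m).trans ?_
  rw [resDer_app i h hw]
  rfl

theorem nablaLin_res {E : Y.Modules} {n : ℕ} {e : Fin n → Γ(E, i ⁻¹ᵁ U.1)} (he : IsFrame E e)
    {v : Derivation k Γ(X, U) Γ(X, U)} {w : Derivation k Γ(Y, i ⁻¹ᵁ U.1) Γ(Y, i ⁻¹ᵁ U.1)}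
    (hw : ∀ a, w ((i.app U.1).hom a) = (i.app U.1).hom (v a)) {W : X.affineOpens}
    (h' : W.1 ≤ V.1) (m : Γ(push i E, V)) :
    nablaLin i (h'.trans h) he hw (resMod (push i E) h' m) =
      resMod (push i E) h' (nablaLin i h he hw m) :=
  he.nabla_res (U := affinePreimage i U) (W := affinePreimage i V) (W' := affinePreimage i W)
    (preimage_le i h) (preimage_le i h) (preimage_le i h') w m

theorem nonempty_deformation [Smooth (X ↘ Spec (.of k))] [Smooth (Y ↘ Spec (.of k))]
    (P : Bivector k X) (E : Y.Modules) {n : ℕ} {e : Fin n → Γ(E, i ⁻¹ᵁ U.1)} (he : IsFrame E e)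
    (hP : ∀ x ∈ idealOf i U.1, ∀ y ∈ idealOf i U.1, P.der U x y ∈ idealOf i U.1) :
    Nonempty (FirstOrderDeformation i P E U) := by
  obtain ⟨r, p, u, v, w, hw, hsum⟩ := exists_decomposition_of_smooth i U (P.der U) hP
  let α (V : X.affineOpens) (hV : V.1 ≤ U.1) :
      Γ(X, V) →ₗ[k] Γ(push i E, V) →ₗ[k] Γ(push i E, V) :=
    liftOf (fun s t => res hV (p s t)) (fun s => resDer hV (u s)) (fun s => resDer hV (v s))
      (fun s => nablaLin i hV he (hw s))
  have hα (V : X.affineOpens) (hV : V.1 ≤ U.1) (a b : Γ(X, V)) (m : Γ(push i E, V)) :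
      assocDefect (P.der V) (α V hV) a b m = 0 := by
    refine assocDefect_liftOf (fun s => nablaLin_smul i hV he (hw s)) _ (fun a b m => ?_) a b m
    rw [← sumDer_apply]
    exact smul_eq_smul_of_app_eq i E (sumDer_res i hV hsum a b) m
  have hres (V W : X.affineOpens) (hV : V.1 ≤ U.1) (h : W.1 ≤ V.1) (a : Γ(X, V))
      (m : Γ(push i E, V)) : α W (h.trans hV) (res h a) (resMod (push i E) h m) =
        resMod (push i E) h (α V hV a m) := by
    have := liftOf_map (X.presheaf.map (homOfLE h).op).hom
      (({ toFun := resMod (push i E) h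
          map_add' := map_add ((push i E).presheaf.map (homOfLE h).op).hom
          map_smul' := resMod_smul_field (push i E) h } :
        Γ(push i E, V) →ₗ[k] Γ(push i E, W))) (resMod_smul (push i E) h)
      (fun s t => res hV (p s t)) (u := fun s => resDer hV (u s)) (v := fun s => resDer hV (v s))
      (D := fun s => nablaLin i hV he (hw s)) (u' := fun s => resDer (h.trans hV) (u s))
      (v' := fun s => resDer (h.trans hV) (v s)) (D' := fun s => nablaLin i (h.trans hV) he (hw s))
      (fun s => res_resDer hV h (u s)) (fun s => res_resDer hV h (v s))
      (fun s => nablaLin_res i hV he (hw s) h) a m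
    -- The two sides differ only in the coefficients `p s t`, restricted to `W` directly or by way
    -- of `V`.
    refine Eq.trans ?_ this
    simp only [α]
    congr 3
    funext s t
    exact (res_res hV h _).symm
  exact ⟨{
    act := fun V hV => actOf (hα V hV)
    act_eps := fun V hV m => by
      rw [actOf_apply (hα V hV)]
      simp
    act_fst := fun V hV a b m => rfl
    act_res := fun V W hV h a b m => by
      rw [actOf_apply (hα V hV), actOf_apply (hα W (h.trans hV)), hres V W hV h]
      refine Prod.ext (resMod_smul (push i E) h a m.1).symm ?_
      simp only [map_add]
      congr 2
      · exact (resMod_smul (push i E) h a m.2).symm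
      · exact (resMod_smul (push i E) h b m.1).symm
    bidiff := ⟨2, fun V hV => ⟨α V hV, fun a m => by rw [actOf_apply (hα V hV)]; simp,
      isDiffOp_liftOf_flip _ _ _ _, isDiffOp_liftOf fun s => nablaLin_smul i hV he (hw s)⟩⟩ }⟩

end Closed

/-! ### The equivalences of the theorem -/

section Main

variable {k : Type u} [Field k] {X Y : Scheme.{u}} [X.Over (Spec (.of k))]
  (i : Y ⟶ X) [IsClosedImmersion i]

theorem obstruction_eq_zero_iff_proj (h2 : (2 : k) ≠ 0) {E : Y.Modules} (hE : IsVectorBundle E)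
    (P : Bivector k X) :
    (∀ V : X.affineOpens, V.1 ≤ ⊤ → (obstruction i E P).1 V = 0) ↔ proj i P = 0 := by
  constructor
  · exact fun h => wedgeN_ext i (wedgeN_eq_zero i hE fun V =>
      (obstrForm_eq_scalarForms (idealOf i V.1) (idealOf_smul i E V.1) h2
        (P.der V) (P.alt V)).symm.trans (h V le_top))
  · intro h V _
    rw [obstruction_eq_zero_iff i h2]
    exact fun x hx y hy => idealOf_smul i E V.1 _ ((proj_eq_zero_iff i P).1 h V x hx y hy)

variable [Smooth (X ↘ Spec (.of k))] [Smooth (i ≫ X ↘ Spec (.of k))]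

theorem locallyDeformable_iff (h2 : (2 : k) ≠ 0) {E : Y.Modules} (hE : IsVectorBundle E)
    (P : Bivector k X) (W : X.Opens) : LocallyDeformable i P E W ↔
      ∀ V : X.affineOpens, V.1 ≤ W → (obstruction i E P).1 V = 0 := by
  refine ⟨fun h => h.obstruction_eq_zero h2, fun h p hp => ?_⟩
  obtain ⟨U, hpU, hUW, ⟨n, e, he⟩, hf⟩ := exists_frame i hE W p hp
  -- `Y` receives the `k`-structure induced from `X`, which makes `i` a morphism over `k`.
  let : Y.Over (Spec (.of k)) := ⟨i ≫ X ↘ Spec (.of k)⟩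
  have : i.IsOver (Spec (.of k)) := ⟨rfl⟩
  have : Smooth (Y ↘ Spec (.of k)) := ‹Smooth (i ≫ X ↘ Spec (.of k))›
  refine ⟨U, hpU, hUW, nonempty_deformation i P E he fun x hx y hy => hf _ ?_⟩
  exact (obstruction_eq_zero_iff i h2 E P U).1 (h U hUW) x hx y hy

end Main

end FirstOrderDef

end

theorem mainTheorem10 {k : Type u} [Field k] (h2 : (2 : k) ≠ 0)
    {X Y : Scheme.{u}} [X.Over (Spec (.of k))] [Smooth (X ↘ Spec (.of k))]
    (i : Y ⟶ X) [IsClosedImmersion i] [Smooth (i ≫ X ↘ Spec (.of k))]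
    (E : Y.Modules) (hE : FirstOrderDef.IsVectorBundle E)
    (P : FirstOrderDef.Bivector k X) :
    (∀ (V : X.affineOpens) (α : Γ(X, V) →ₗ[k] Γ(FirstOrderDef.push i E, V) →ₗ[k]
          Γ(FirstOrderDef.push i E, V)) (x y : Γ(X, V))
        (hx : x ∈ FirstOrderDef.idealOf i V.1) (hy : y ∈ FirstOrderDef.idealOf i V.1)
        (e : Γ(FirstOrderDef.push i E, V)),
        ((FirstOrderDef.obstruction i E P).1 V).1 (FirstOrderDef.conormal i V.1 x hx)
            (FirstOrderDef.conormal i V.1 y hy) e =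
          FirstOrderDef.assocDefect (P.der V) α x y e -
            FirstOrderDef.assocDefect (P.der V) α y x e) ∧
    Function.Injective (FirstOrderDef.inclusion i E) ∧
    FirstOrderDef.obstruction i E P =
      FirstOrderDef.inclusion i E (FirstOrderDef.proj i P) ∧
    (∀ W : X.Opens, FirstOrderDef.LocallyDeformable i P E W ↔
      ∀ V : X.affineOpens, V.1 ≤ W → (FirstOrderDef.obstruction i E P).1 V = 0) ∧
    (FirstOrderDef.LocallyDeformable i P E ⊤ ↔ FirstOrderDef.proj i P = 0) ∧
    (FirstOrderDef.proj i P = 0 ↔ FirstOrderDef.IsCoisotropic P i) := by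
  refine ⟨fun V α x y hx hy e => FirstOrderDef.obstruction_apply_lift i E P V α hx hy e,
    FirstOrderDef.inclusion_injective i hE, FirstOrderDef.obstruction_eq_inclusion i h2 E P,
    FirstOrderDef.locallyDeformable_iff i h2 hE P, ?_, FirstOrderDef.proj_eq_zero_iff i P⟩
  exact (FirstOrderDef.locallyDeformable_iff i h2 hE P ⊤).trans
    (FirstOrderDef.obstruction_eq_zero_iff_proj i h2 hE P)
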